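/- For $N\ge 1$ let $f_N:\mathbb{R}^N\to\mathbb{R}\cup\{\infty\}$ be $f_N(x)=x(N)-x(1)$ if $x(1)\le x(2)\le\dots\le x(N)$, and $f_N(x)=\infty$ otherwise. For $x_0\in\mathbb{R}^N$ let $$\mathcal{D}(f_N,x_0)=\bigcup_{\tau>0}\{y\in\mathbb{R}^N: f_N(x_0+\tau y)\le f_N(x_0)\}$$ be the descent cone of $f_N$ at $x_0$. For a closed convex cone $C\subseteq\mathbb{R}^N$ let $\delta(C)=\mathbb{E}\,\|\Pi_C(g)\|^2$ be its statistical dimension, where $g$ is a standard Gaussian vector in $\mathbb{R}^N$ and $\Pi_C$ is the Euclidean projection onto $C$. The change points of a monotone signal $x_0\in\mathbb{R}^N$ are the indices $i\in\{2,\dots,N\}$ with $x_0(i)>x_0(i-1)$. For each $N$ and each $S\subseteq\{2,\dots,N\}$ let $x_S\in\mathbb{R}^N$ be any monotone signal whose set of change points is exactly $S$. **Theorem.** Let $0<\varepsilon<1$, and let $N,k\to\infty$ along integers with $k/N\to\varepsilon$ (in particular this covers $k/N=\varepsilon$). Then the statistical dimension, normalized by $N$ and averaged over the choice of the $k$ change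 points uniformly at random, converges: $$\binom{N-1}{k}^{-1}\sum_{\substack{S\subseteq\{2,\dots,N\}\\ |S|=k}}\frac{1}{N}\,\delta\bigl(\mathcal{D}(f_N,x_S)\bigr)\;\longrightarrow\;\frac{\varepsilon\log(1/\varepsilon)}{1-\varepsilon}.$$ This holds for every choice of the signals $x_S$. -/

import Mathlib

open Filter Topology MeasureTheory ProbabilityTheory

noncomputable section

/-- The total variation norm restricted to monotone signals: `x(N) - x(1)` if
`x(1) ≤ x(2) ≤ … ≤ x(N)`, and `∞` otherwise. Coordinates are numbered from `0` in `Fin N`.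
The empty signal gets the value `0`. -/
def monotoneTV : (N : ℕ) → EuclideanSpace ℝ (Fin N) → EReal
  | 0, _ => 0
  | N + 1, x =>
    open Classical in
    if Monotone (fun i => x i) then ((x (Fin.last N) - x 0 : ℝ) : EReal) else ⊤

/-- The descent cone of `f` at `x`: `⋃_{τ > 0} {y : f (x + τ y) ≤ f x}`. -/
def descentCone {E : Type*} [AddCommGroup E] [Module ℝ E] (f : E → EReal) (x : E) : Set E :=
  ⋃ τ ∈ Set.Ioi (0 : ℝ), {y : E | f (x + τ • y) ≤ f x}

/-- `p` is a point of `C` nearest to `g`. -/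
def IsNearestPoint {E : Type*} [NormedAddCommGroup E] (C : Set E) (g p : E) : Prop :=
  p ∈ C ∧ ∀ q ∈ C, ‖g - p‖ ≤ ‖g - q‖

/-- Metric projection onto `C` (the value `0` is used if there is no nearest point, which does not
happen when `C` is nonempty, closed and convex in a Euclidean space). -/
def metricProj {E : Type*} [NormedAddCommGroup E] (C : Set E) (g : E) : E :=
  open Classical in if h : ∃ p, IsNearestPoint C g p then h.choose else 0

/-- On a nonempty closed convex set `metricProj` is the unique nearest point. -/
theorem isNearestPoint_iff_eq_metricProj {E : Type*} [NormedAddCommGroup E]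
    [InnerProductSpace ℝ E] [CompleteSpace E] {C : Set E} (hne : C.Nonempty) (hcl : IsClosed C)
    (hco : Convex ℝ C) (g p : E) : IsNearestPoint C g p ↔ p = metricProj C g := by
  have key : ∀ q, IsNearestPoint C g q → ∀ w ∈ C, inner ℝ (g - q) (w - q) ≤ 0 := by
    intro q hq
    refine (norm_eq_iInf_iff_real_inner_le_zero hco hq.1).1 ?_
    have : Nonempty C := ⟨⟨q, hq.1⟩⟩
    refine le_antisymm (le_ciInf fun w => hq.2 w w.2) ?_
    exact ciInf_le ⟨0, by rintro _ ⟨w, rfl⟩; exact norm_nonneg _⟩ (⟨q, hq.1⟩ : C)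
  have uniq : ∀ q r, IsNearestPoint C g q → IsNearestPoint C g r → q = r := by
    intro q r hq hr
    have h1 := key q hq r hr.1
    have h2 := key r hr q hq.1
    have h3 : inner ℝ (r - q) (r - q) ≤ 0 := by
      have e : inner ℝ (r - q) (r - q)
          = inner ℝ (g - q) (r - q) + inner ℝ (g - r) (q - r) := by
        have : q - r = -(r - q) := by abel
        rw [this, inner_neg_right, ← sub_eq_add_neg, ← inner_sub_left]
        congr 1
        abel
      rw [e]; linarith
    have h4 : r - q = 0 := real_inner_self_nonpos.1 h3
    exact (sub_eq_zero.1 h4).symm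
  have ex : ∃ q, IsNearestPoint C g q := by
    obtain ⟨v, hv, h⟩ := exists_norm_eq_iInf_of_complete_convex hne hcl.isComplete hco g
    refine ⟨v, hv, fun w hw => ?_⟩
    rw [h]
    exact ciInf_le ⟨0, by rintro _ ⟨w, rfl⟩; exact norm_nonneg _⟩ (⟨w, hw⟩ : C)
  have spec : IsNearestPoint C g (metricProj C g) := by
    unfold metricProj
    rw [dif_pos ex]
    exact ex.choose_spec
  exact ⟨fun h => uniq _ _ h spec, fun h => h ▸ spec⟩

/-- The statistical dimension `δ(C) = 𝔼 ‖Π_C(g)‖²` for a standard Gaussian vector `g` in `ℝ^N`. -/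
def statDim {N : ℕ} (C : Set (EuclideanSpace ℝ (Fin N))) : ℝ :=
  ∫ g, ‖metricProj C g‖ ^ 2 ∂(stdGaussian (EuclideanSpace ℝ (Fin N)))

/-- The set of change points of a signal: the positions `i`, other than the first one, with
`x(i) > x(i-1)`. -/
def changePoints {N : ℕ} (x : EuclideanSpace ℝ (Fin N)) : Finset (Fin N) :=
  open Classical in
  Finset.univ.filter (fun i => ∃ j : Fin N, (j : ℕ) + 1 = i ∧ x j < x i)

/-- The positions that can be change points: all but the first one. -/
def possibleChangePoints (N : ℕ) : Finset (Fin N) :=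
  Finset.univ.filter (fun i => 0 < (i : ℕ))

/-- Average, over all `k`-element sets `S` of possible change points, with equal weights, of the
statistical dimension divided by `N` of the descent cone of `monotoneTV` at the signal `x S`. -/
def averageNormalizedSD (N k : ℕ) (x : Finset (Fin N) → EuclideanSpace ℝ (Fin N)) : ℝ :=
  (∑ S ∈ (possibleChangePoints N).powersetCard k,
      statDim (descentCone (monotoneTV N) (x S)) / (N : ℝ)) /
    (((possibleChangePoints N).powersetCard k).card : ℝ)

end

/-!
On a monotone signal `x` the value of `f_N` is `x N - x 1`, so the descent cone at `x` consists of
the `y` that increase at every step outside the set `S` of change points and satisfy `y N ≤ y 1`.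
The last condition is the missing step at position `1`, which is never a change point: the cone is
cyclic, and `S` cuts `ℤ / N` into blocks on which `y` has to increase.

The projection onto the cone is the isotonic regression on each block, that is, the sequence of
slopes of the greatest convex minorant of the random walk whose increments are the Gaussian
coordinates of the block. A face of the minorant of length `m` over which the walk rises by `r`
contributes `r ^ 2 / m` to the squared norm. As in Spitzer's identity, exchangeability of the
increments shows that a sum over the faces of length `m` has the same expectation as `1 / m` times
the summand of the first `m` steps. Since the walk has variance `m` after `m` steps, a block of
length `l` contributes `∑_{m ≤ l} 1 / m`, the `l`-th harmonic number.

So the normalized average is the sum over `j` of `1 / (j + 1)` times the mean number, per site, of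
blocks longer than `j`. A site starts such a block if it is a change point and the next `j` sites
are not, which has limiting probability `ε (1 - ε) ^ j`. As blocks longer than `j` occupy at least
`j + 1` sites, the mean number is at most `1 / (j + 1)`, and dominated convergence gives the limit
`∑ j, ε (1 - ε) ^ j / (j + 1) = ε log (1 / ε) / (1 - ε)`.
-/

noncomputable section

/-- The walk with increments `h`, started at `0`. -/
def walk (h : ℕ → ℝ) (t : ℕ) : ℝ := ∑ a ∈ Finset.range t, h a

/-- The slope of the chord of the walk over the `m` steps starting at time `i`; it is `0` for
`m = 0`. -/
def chordSlope (h : ℕ → ℝ) (i m : ℕ) : ℝ := (walk h (i + m) - walk h i) / m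

/-- The walk minus the line of slope `v` through the origin. -/
def tiltedWalk (h : ℕ → ℝ) (v : ℝ) (t : ℕ) : ℝ := walk h t - v * t

/-- The chord over the `m` steps starting at time `i` is contained in a face of the greatest convex
minorant of the walk on `[0, l]`: the walk stays above the line spanned by the chord. -/
def IsFace (l : ℕ) (h : ℕ → ℝ) (i m : ℕ) : Prop :=
  0 < m ∧ i + m ≤ l ∧ IsMinOn (tiltedWalk h (chordSlope h i m)) (Set.Iic l) i

open Classical in
/-- The chords contained in faces of the convex minorant on `[0, l]`, as pairs of a starting time
and a length. -/
def faces (l : ℕ) (h : ℕ → ℝ) : Finset (ℕ × ℕ) :=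
  {c ∈ Finset.range l ×ˢ Finset.Icc 1 l | IsFace l h c.1 c.2}

/-- Different chords of the walk have different slopes. It makes the chords in `faces` the maximal
faces of the convex minorant. -/
def DistinctSlopes (h : ℕ → ℝ) : Prop :=
  Set.InjOn (fun c : ℕ × ℕ => chordSlope h c.1 c.2) {c | 0 < c.2}

section Faces

variable {l i m i' m' : ℕ} {h : ℕ → ℝ}

theorem walk_zero (h : ℕ → ℝ) : walk h 0 = 0 := Finset.sum_range_zero h

theorem walk_add_sub_walk (h : ℕ → ℝ) (hm : 0 < m) (i : ℕ) :
    walk h (i + m) - walk h i = chordSlope h i m * m :=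
  (div_mul_cancel₀ _ (by positivity)).symm

theorem mem_faces {c : ℕ × ℕ} : c ∈ faces l h ↔ IsFace l h c.1 c.2 := by
  simp only [faces, Finset.mem_filter, Finset.mem_product, Finset.mem_range, Finset.mem_Icc,
    and_iff_right_iff_imp]
  rintro ⟨hm, hl, -⟩
  omega

theorem IsFace.le_walk (H : IsFace l h i m) {t : ℕ} (ht : t ≤ l) :
    walk h i + chordSlope h i m * (t - i) ≤ walk h t := by
  have := isMinOn_iff.1 H.2.2 t ht
  simp only [tiltedWalk] at this
  linarith

theorem IsFace.add_le_of_chordSlope_lt (H : IsFace l h i m) (H' : IsFace l h i' m')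
    (hlt : chordSlope h i m < chordSlope h i' m') : i + m ≤ i' := by
  have below_right := H.le_walk (t := i') (by have := H'.2.1; omega)
  have below_left := H'.le_walk H.2.1
  have rise := walk_add_sub_walk h H.1 i
  have hprod : (chordSlope h i' m' - chordSlope h i m) * (((i + m : ℕ) : ℝ) - i') ≤ 0 := by
    push_cast at *
    linear_combination below_right + below_left + rise
  have := nonpos_of_mul_nonpos_right hprod (sub_pos.2 hlt)
  exact_mod_cast sub_nonpos.1 this

theorem IsFace.chordSlope_eq (H : IsFace l h i m) (H' : IsFace l h i' m') (hi : i < i' + m')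
    (hi' : i' < i + m) : chordSlope h i m = chordSlope h i' m' := by
  by_contra hne
  rcases lt_or_gt_of_ne hne with hlt | hlt
  · exact hi'.not_ge (H.add_le_of_chordSlope_lt H' hlt)
  · exact hi.not_ge (H'.add_le_of_chordSlope_lt H hlt)

theorem DistinctSlopes.pairwiseDisjoint_faces (hd : DistinctSlopes h) :
    (faces l h : Set (ℕ × ℕ)).PairwiseDisjoint fun c => Finset.Ico c.1 (c.1 + c.2) := by
  intro c hc c' hc' hne
  rw [Finset.mem_coe, mem_faces] at hc hc'
  rw [Function.onFun, Finset.disjoint_left]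
  intro t ht ht'
  rw [Finset.mem_Ico] at ht ht'
  exact hne (hd hc.1 hc'.1 (hc.chordSlope_eq hc' (by omega) (by omega)))

end Faces

/-- `p` is the isotonic regression of `h` on the first `l` indices, that is, the projection of `h`
onto the cone of sequences that are monotone there, in variational form. -/
structure IsIsotonicRegression (l : ℕ) (h p : ℕ → ℝ) : Prop where
  monotoneOn : MonotoneOn p (Set.Iio l)
  sum_mul_self : ∑ t ∈ Finset.range l, (h t - p t) * p t = 0
  sum_mul_nonpos (q : ℕ → ℝ) (hq : MonotoneOn q (Set.Iio l)) :
    ∑ t ∈ Finset.range l, (h t - p t) * q t ≤ 0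

namespace IsIsotonicRegression

variable {l : ℕ} {h p : ℕ → ℝ}

theorem sum_mul_indicator (h p : ℕ → ℝ) {t : ℕ} (ht : t ≤ l) (c : ℝ) :
    ∑ u ∈ Finset.range l, (h u - p u) * (if u < t then c else 0) =
      c * (walk h t - walk p t) := by
  have hfilter : {u ∈ Finset.range l | u < t} = Finset.range t := by
    ext u
    simp only [Finset.mem_filter, Finset.mem_range]
    omega
  simp only [mul_ite, mul_zero]
  rw [← Finset.sum_filter, hfilter, ← Finset.sum_mul, Finset.sum_sub_distrib, mul_comm, walk, walk]

theorem walk_le (H : IsIsotonicRegression l h p) {t : ℕ} (ht : t ≤ l) : walk p t ≤ walk h t := by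
  have := H.sum_mul_nonpos (fun u => if u < t then -1 else 0) fun u _ v _ huv => by
    dsimp only
    split_ifs <;> first | omega | norm_num
  rw [sum_mul_indicator h p ht] at this
  linarith

theorem walk_eq_at_end (H : IsIsotonicRegression l h p) : walk p l = walk h l := by
  have := H.sum_mul_nonpos (fun _ => 1) monotoneOn_const
  simp only [mul_one, Finset.sum_sub_distrib] at this
  exact le_antisymm (H.walk_le le_rfl) (sub_nonpos.1 this)

theorem walk_eq_of_lt (H : IsIsotonicRegression l h p) {t : ℕ} (ht : t + 1 < l)
    (hjump : p t < p (t + 1)) : walk p (t + 1) = walk h (t + 1) := by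
  refine le_antisymm (H.walk_le ht.le) ?_
  have hmono : MonotoneOn (fun u => p u + if u < t + 1 then p (t + 1) - p t else 0)
      (Set.Iio l) := by
    intro u hu v hv huv
    have huv' := H.monotoneOn hu hv huv
    dsimp only
    split_ifs with hut hvt hvt
    · linarith
    · have := H.monotoneOn hu (show t ∈ Set.Iio l by simp only [Set.mem_Iio]; omega) (by omega)
      have := H.monotoneOn (show t + 1 ∈ Set.Iio l from ht) hv (by omega)
      linarith
    · omega
    · linarith
  have := H.sum_mul_nonpos _ hmono
  simp only [mul_add, Finset.sum_add_distrib, H.sum_mul_self, zero_add,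
    sum_mul_indicator h p ht.le] at this
  exact sub_nonpos.1 (nonpos_of_mul_nonpos_right this (sub_pos.2 hjump))

theorem le_walk (H : IsIsotonicRegression l h p) {i t : ℕ} (hi : i < l) (ht : t ≤ l) :
    walk p i + p i * (t - i) ≤ walk p t := by
  rcases le_total i t with hit | hti
  · have := Finset.card_nsmul_le_sum (Finset.Ico i t) p (p i) fun u hu => by
      rw [Finset.mem_Ico] at hu
      exact H.monotoneOn hi (show u < l by omega) hu.1
    rw [Finset.sum_Ico_eq_sub p hit, Nat.card_Ico, nsmul_eq_mul, Nat.cast_sub hit] at this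
    simp only [walk]
    linarith
  · have := Finset.sum_le_card_nsmul (Finset.Ico t i) p (p i) fun u hu => by
      rw [Finset.mem_Ico] at hu
      exact H.monotoneOn (show u < l by omega) hi hu.2.le
    rw [Finset.sum_Ico_eq_sub p hti, Nat.card_Ico, nsmul_eq_mul, Nat.cast_sub hti] at this
    simp only [walk]
    linarith

theorem exists_le_walk_eq (H : IsIsotonicRegression l h p) {a : ℕ} (ha : a < l) :
    ∃ i ≤ a, p i = p a ∧ walk p i = walk h i := by
  induction a with
  | zero => exact ⟨0, le_rfl, rfl, by rw [walk_zero, walk_zero]⟩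
  | succ a ih =>
    rcases (H.monotoneOn (show a < l by omega) ha a.le_succ).eq_or_lt with heq | hjump
    · obtain ⟨i, hia, hi, hwalk⟩ := ih (by omega)
      exact ⟨i, by omega, hi.trans heq, hwalk⟩
    · exact ⟨a + 1, le_rfl, rfl, H.walk_eq_of_lt ha hjump⟩

theorem exists_ge_walk_eq (H : IsIsotonicRegression l h p) {a : ℕ} (ha : a < l) :
    ∃ b ≥ a, b < l ∧ p b = p a ∧ walk p (b + 1) = walk h (b + 1) := by
  induction hn : l - (a + 1) generalizing a with
  | zero =>
    obtain rfl : l = a + 1 := by omega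
    exact ⟨a, le_rfl, ha, rfl, H.walk_eq_at_end⟩
  | succ n ih =>
    have ha' : a + 1 < l := by omega
    rcases (H.monotoneOn ha ha' a.le_succ).eq_or_lt with heq | hjump
    · obtain ⟨b, hab, hb, hpb, hwalk⟩ := ih ha' (by omega)
      exact ⟨b, by omega, hb, hpb.trans heq.symm, hwalk⟩
    · exact ⟨a, le_rfl, ha, rfl, H.walk_eq_of_lt ha' hjump⟩

theorem exists_isFace (H : IsIsotonicRegression l h p) {a : ℕ} (ha : a < l) :
    ∃ i m, IsFace l h i m ∧ a ∈ Finset.Ico i (i + m) ∧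
      ∀ t ∈ Finset.Ico i (i + m), p t = chordSlope h i m := by
  obtain ⟨i, hia, hpi, hwalk_i⟩ := H.exists_le_walk_eq ha
  obtain ⟨b, hab, hb, hpb, hwalk_b⟩ := H.exists_ge_walk_eq ha
  obtain ⟨m, hm⟩ := Nat.exists_eq_add_of_le (show i + 1 ≤ b + 1 by omega)
  have hlevel : ∀ t ∈ Finset.Ico i (i + (m + 1)), p t = p a := by
    intro t ht
    rw [Finset.mem_Ico] at ht
    exact le_antisymm ((H.monotoneOn (show t < l by omega) hb (by omega)).trans_eq hpb)
      (hpi.symm.trans_le (H.monotoneOn (show i < l by omega) (show t < l by omega) ht.1))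
  have hslope : chordSlope h i (m + 1) = p a := by
    rw [chordSlope, show i + (m + 1) = b + 1 by omega, ← hwalk_i, ← hwalk_b, walk, walk,
      ← Finset.sum_Ico_eq_sub p (by omega), show b + 1 = i + (m + 1) by omega,
      Finset.sum_congr rfl hlevel, Finset.sum_const, Nat.card_Ico, Nat.add_sub_cancel_left,
      nsmul_eq_mul, mul_div_cancel_left₀ _ (by positivity)]
  refine ⟨i, m + 1, ⟨m.succ_pos, by omega, isMinOn_iff.2 fun t ht => ?_⟩,
    Finset.mem_Ico.2 (by omega), fun t ht => (hlevel t ht).trans hslope.symm⟩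
  have hbelow := (H.le_walk (show i < l by omega) ht).trans (H.walk_le ht)
  rw [hpi, hwalk_i] at hbelow
  simp only [tiltedWalk, hslope]
  linarith

theorem eq_chordSlope (H : IsIsotonicRegression l h p) {i m t : ℕ} (hface : IsFace l h i m)
    (ht : t ∈ Finset.Ico i (i + m)) : p t = chordSlope h i m := by
  have hl := hface.2.1
  simp only [Finset.mem_Ico] at ht
  obtain ⟨i', m', hface', ht', hslope⟩ := H.exists_isFace (show t < l by omega)
  rw [hslope t ht']
  rw [Finset.mem_Ico] at ht'
  exact hface'.chordSlope_eq hface (by omega) (by omega)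

theorem sum_comp_eq_sum_faces (H : IsIsotonicRegression l h p) (hd : DistinctSlopes h)
    (φ : ℝ → ℝ) : ∑ t ∈ Finset.range l, φ (p t) =
      ∑ c ∈ faces l h, c.2 * φ (chordSlope h c.1 c.2) := by
  have hcover : Finset.range l = (faces l h).biUnion fun c => Finset.Ico c.1 (c.1 + c.2) := by
    ext t
    simp only [Finset.mem_range, Finset.mem_biUnion, mem_faces, Prod.exists]
    constructor
    · intro ht
      obtain ⟨i, m, hface, hmem, -⟩ := H.exists_isFace ht
      exact ⟨i, m, hface, hmem⟩
    · rintro ⟨i, m, ⟨-, hl, -⟩, hmem⟩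
      rw [Finset.mem_Ico] at hmem
      omega
  rw [hcover, Finset.sum_biUnion hd.pairwiseDisjoint_faces]
  refine Finset.sum_congr rfl fun c hc => ?_
  rw [Finset.sum_congr rfl fun t ht => by rw [H.eq_chordSlope (mem_faces.1 hc) ht],
    Finset.sum_const, Nat.card_Ico, nsmul_eq_mul, Nat.add_sub_cancel_left]

end IsIsotonicRegression

section Exchangeable

/-- The walk minus the chord over its first `m` steps. -/
def bridge (h : ℕ → ℝ) (m : ℕ) : ℕ → ℝ := tiltedWalk h (chordSlope h 0 m)

/-- The permutation of the indices that exchanges the first `p` of them with the next `q`: the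
sequence `h ∘ blockSwap p q` starts with `h p, …, h (p + q - 1), h 0, …, h (p - 1)`. -/
def blockSwap (p q a : ℕ) : ℕ := if a < q then p + a else if a < p + q then a - q else a

/-- Exchangeability of a random sequence with law `μ`, as invariance under every injective
reindexing; for probability measures this is equivalent to invariance under permutations of
finitely many indices. -/
def IsExchangeable {E : Type*} [MeasurableSpace E] (μ : Measure (ℕ → E)) : Prop :=
  ∀ σ : ℕ → ℕ, σ.Injective → MeasurePreserving (fun h => h ∘ σ) μ μ

theorem blockSwap_injective (p q : ℕ) : (blockSwap p q).Injective := by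
  intro a b hab
  simp only [blockSwap] at hab
  split_ifs at hab <;> omega

theorem walk_add (h : ℕ → ℝ) (s t : ℕ) : walk h (s + t) = walk h s + walk (fun a => h (s + a)) t :=
  Finset.sum_range_add h s t

theorem walk_congr {h h' : ℕ → ℝ} {t : ℕ} (heq : ∀ a < t, h a = h' a) : walk h t = walk h' t :=
  Finset.sum_congr rfl fun a ha => heq a (Finset.mem_range.1 ha)

section BlockSwap

variable (h : ℕ → ℝ) {p q t : ℕ}

theorem walk_blockSwap_of_le (ht : t ≤ q) :
    walk (h ∘ blockSwap p q) t = walk h (p + t) - walk h p := by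
  rw [walk_add, add_sub_cancel_left]
  refine walk_congr fun a ha => ?_
  simp only [Function.comp_apply, blockSwap, if_pos (ha.trans_le ht)]

theorem walk_blockSwap_add_of_le (ht : t ≤ p) :
    walk (h ∘ blockSwap p q) (q + t) = walk h (p + q) - walk h p + walk h t := by
  rw [walk_add, walk_blockSwap_of_le h le_rfl, add_right_inj]
  refine walk_congr fun a ha => ?_
  simp only [Function.comp_apply, blockSwap]
  rw [if_neg (by omega), if_pos (by omega), Nat.add_sub_cancel_left]

theorem walk_blockSwap_of_ge (ht : p + q ≤ t) : walk (h ∘ blockSwap p q) t = walk h t := by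
  obtain ⟨u, rfl⟩ := Nat.exists_eq_add_of_le ht
  have hblocks : walk (h ∘ blockSwap p q) (p + q) = walk h (p + q) := by
    rw [add_comm, walk_blockSwap_add_of_le h le_rfl, add_comm q, sub_add_cancel]
  rw [walk_add _ (p + q), walk_add _ (p + q), hblocks, add_right_inj]
  refine walk_congr fun a _ => ?_
  simp only [Function.comp_apply, blockSwap]
  rw [if_neg (by omega), if_neg (by omega)]

theorem tiltedWalk_blockSwap_of_le (v : ℝ) (ht : t ≤ q) :
    tiltedWalk (h ∘ blockSwap p q) v t = tiltedWalk h v (p + t) - tiltedWalk h v p := by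
  simp only [tiltedWalk, walk_blockSwap_of_le h ht]
  push_cast
  ring

theorem tiltedWalk_blockSwap_add_of_le (v : ℝ) (ht : t ≤ p) :
    tiltedWalk (h ∘ blockSwap p q) v (q + t) =
      tiltedWalk h v (p + q) - tiltedWalk h v p + tiltedWalk h v t := by
  simp only [tiltedWalk, walk_blockSwap_add_of_le h ht]
  push_cast
  ring

theorem tiltedWalk_blockSwap_of_ge (v : ℝ) (ht : p + q ≤ t) :
    tiltedWalk (h ∘ blockSwap p q) v t = tiltedWalk h v t := by
  simp only [tiltedWalk, walk_blockSwap_of_ge h ht]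

end BlockSwap

section Bridge

variable (h : ℕ → ℝ)

theorem bridge_zero (m : ℕ) : bridge h m 0 = 0 := by
  simp [bridge, tiltedWalk, walk_zero]

theorem bridge_self {m : ℕ} (hm : 0 < m) : bridge h m m = 0 := by
  have := walk_add_sub_walk h hm 0
  rw [zero_add, walk_zero] at this
  simp only [bridge, tiltedWalk]
  linarith

/-- Exchanging two blocks acts on the bridge over both of them as a cyclic shift. -/
theorem isMinOn_bridge_blockSwap_iff (r : ℕ) {q : ℕ} (hq : 0 < q) :
    IsMinOn (bridge (h ∘ blockSwap r q) (r + q)) (Set.Iio (r + q)) 0 ↔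
      IsMinOn (bridge h (r + q)) (Set.Iio (r + q)) r := by
  have hslope : chordSlope (h ∘ blockSwap r q) 0 (r + q) = chordSlope h 0 (r + q) := by
    rw [chordSlope, chordSlope, zero_add, walk_blockSwap_of_ge h le_rfl, walk_zero, walk_zero]
  have hfirst {t : ℕ} (ht : t ≤ q) : bridge (h ∘ blockSwap r q) (r + q) t =
      bridge h (r + q) (r + t) - bridge h (r + q) r := by
    rw [bridge, hslope, tiltedWalk_blockSwap_of_le h _ ht, bridge]
  have hsecond {u : ℕ} (hu : u ≤ r) : bridge (h ∘ blockSwap r q) (r + q) (q + u) =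
      bridge h (r + q) u - bridge h (r + q) r := by
    rw [bridge, hslope, tiltedWalk_blockSwap_add_of_le h _ hu, ← bridge,
      bridge_self h (show 0 < r + q by omega)]
    ring
  simp only [isMinOn_iff, bridge_zero]
  constructor
  · intro H t ht
    rcases lt_or_ge t r with htr | htr
    · exact sub_nonneg.1 (hsecond htr.le ▸ H (q + t) (by simp only [Set.mem_Iio]; omega))
    · obtain ⟨u, rfl⟩ := Nat.exists_eq_add_of_le htr
      rw [Set.mem_Iio] at ht
      exact sub_nonneg.1 (hfirst (show u ≤ q by omega) ▸ H u (by simp only [Set.mem_Iio]; omega))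
  · intro H t ht
    rw [Set.mem_Iio] at ht
    rcases lt_or_ge t q with htq | htq
    · exact hfirst htq.le ▸ sub_nonneg.2 (H (r + t) (by simp only [Set.mem_Iio]; omega))
    · obtain ⟨u, rfl⟩ := Nat.exists_eq_add_of_le htq
      exact hsecond (show u ≤ r by omega) ▸
        sub_nonneg.2 (H u (by simp only [Set.mem_Iio]; omega))

theorem walk_blockSwap_chord (m i : ℕ) :
    walk (h ∘ blockSwap m i) (i + m) - walk (h ∘ blockSwap m i) i = walk h m := by
  rw [walk_blockSwap_add_of_le h le_rfl, walk_blockSwap_of_le h le_rfl, add_sub_cancel_left]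

theorem isFace_blockSwap_iff {l m : ℕ} (hm : 0 < m) (i : ℕ) :
    IsFace l (h ∘ blockSwap m i) i m ↔ IsMinOn (bridge h m) (Set.Iio m) 0 ∧
      m + i ∈ Finset.Icc m l ∧ IsMinOn (bridge h m) (Finset.Icc m l) (m + i) := by
  have hslope : chordSlope (h ∘ blockSwap m i) i m = chordSlope h 0 m := by
    rw [chordSlope, walk_blockSwap_chord, chordSlope, zero_add, walk_zero, sub_zero]
  have hend := bridge_self h hm
  have hfirst {t : ℕ} (ht : t ≤ i) :
      tiltedWalk (h ∘ blockSwap m i) (chordSlope h 0 m) t = bridge h m (m + t) := by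
    rw [tiltedWalk_blockSwap_of_le h _ ht, ← bridge, hend, sub_zero]
  have hsecond {u : ℕ} (hu : u ≤ m) :
      tiltedWalk (h ∘ blockSwap m i) (chordSlope h 0 m) (i + u) =
        bridge h m (m + i) + bridge h m u := by
    rw [tiltedWalk_blockSwap_add_of_le h _ hu, ← bridge, hend, sub_zero]
  have hlast {t : ℕ} (ht : m + i ≤ t) :
      tiltedWalk (h ∘ blockSwap m i) (chordSlope h 0 m) t = bridge h m t :=
    tiltedWalk_blockSwap_of_ge h _ ht
  simp only [IsFace, hslope, isMinOn_iff, hfirst le_rfl, bridge_zero, Finset.coe_Icc, Set.mem_Icc,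
    Finset.mem_Icc, Set.mem_Iic, Set.mem_Iio]
  constructor
  · rintro ⟨-, hl, H⟩
    refine ⟨fun u hu => ?_, by omega, fun t ht => ?_⟩
    · exact nonneg_of_le_add_right (hsecond hu.le ▸ H (i + u) (by omega))
    · rcases le_total (m + i) t with hmt | hmt
      · exact hlast hmt ▸ H t ht.2
      · obtain ⟨u, rfl⟩ := Nat.exists_eq_add_of_le ht.1
        exact hfirst (show u ≤ i by omega) ▸ H u (by omega)
  · rintro ⟨Hbridge, hl, H⟩
    refine ⟨hm, by omega, fun t ht => ?_⟩
    rcases le_total t i with hti | hti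
    · exact hfirst hti ▸ H (m + t) (by omega)
    rcases le_total (m + i) t with hmt | hmt
    · exact hlast hmt ▸ H t ⟨by omega, ht⟩
    obtain ⟨u, rfl⟩ := Nat.exists_eq_add_of_le hti
    rw [hsecond (by omega), le_add_iff_nonneg_right]
    rcases (show u ≤ m by omega).lt_or_eq with hu | rfl
    · exact Hbridge u hu
    · exact hend.ge

end Bridge

theorem DistinctSlopes.injOn_bridge {h : ℕ → ℝ} (hd : DistinctSlopes h) {m : ℕ} (hm : 0 < m)
    {s : Set ℕ} (hs : 0 ∈ s → m ∉ s) : s.InjOn (bridge h m) := by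
  have ends_of_eq {t d : ℕ} (heq : bridge h m t = bridge h m (t + (d + 1))) :
      t = 0 ∧ d + 1 = m := by
    have hslope : chordSlope h t (d + 1) = chordSlope h 0 m := by
      simp only [bridge, tiltedWalk] at heq
      rw [chordSlope, div_eq_iff (by positivity)]
      push_cast at heq ⊢
      linear_combination -heq
    exact Prod.ext_iff.1 (@hd (t, d + 1) d.succ_pos (0, m) hm hslope)
  intro t ht t' ht' heq
  by_contra hne
  rcases lt_or_gt_of_ne hne with hlt | hlt
  · obtain ⟨d, rfl⟩ := Nat.exists_eq_add_of_lt hlt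
    obtain ⟨rfl, rfl⟩ := ends_of_eq heq
    exact hs ht (by simpa only [zero_add] using ht')
  · obtain ⟨d, rfl⟩ := Nat.exists_eq_add_of_lt hlt
    obtain ⟨rfl, rfl⟩ := ends_of_eq heq.symm
    exact hs ht' (by simpa only [zero_add] using ht)

theorem existsUnique_isMinOn {ι α : Type*} [LinearOrder α] {s : Finset ι} (hs : s.Nonempty)
    {f : ι → α} (hf : (s : Set ι).InjOn f) : ∃! i, i ∈ s ∧ IsMinOn f s i := by
  obtain ⟨i, hi, hmin⟩ := s.exists_min_image f hs
  refine ⟨i, ⟨hi, isMinOn_iff.2 hmin⟩, fun j ⟨hj, hjmin⟩ => hf hj hi ?_⟩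
  exact le_antisymm (isMinOn_iff.1 hjmin i hi) (hmin j hj)

theorem sum_setIntegral_of_existsUnique {Ω ι E : Type*} [MeasurableSpace Ω] [NormedAddCommGroup E]
    [NormedSpace ℝ E] {μ : Measure Ω} {s : Finset ι} {A : ι → Set Ω}
    (hA : ∀ i ∈ s, MeasurableSet (A i)) (hunique : ∀ᵐ ω ∂μ, ∃! i, i ∈ s ∧ ω ∈ A i) {F : Ω → E}
    (hF : Integrable F μ) : ∑ i ∈ s, ∫ ω in A i, F ω ∂μ = ∫ ω, F ω ∂μ := by
  rw [Finset.sum_congr rfl fun i hi => (integral_indicator (hA i hi)).symm,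
    ← integral_finsetSum _ fun i hi => hF.indicator (hA i hi)]
  refine integral_congr_ae (hunique.mono fun ω ⟨i, ⟨hi, hiA⟩, huniq⟩ => ?_)
  dsimp only
  rw [Finset.sum_eq_single_of_mem i hi fun j hj hji =>
    Set.indicator_of_notMem (fun hjA => hji (huniq j ⟨hj, hjA⟩)) F, Set.indicator_of_mem hiA]

theorem IsExchangeable.setIntegral_comp {E F : Type*} [MeasurableSpace E] [NormedAddCommGroup F]
    [NormedSpace ℝ F] {μ : Measure (ℕ → E)} (hμ : IsExchangeable μ) {σ : ℕ → ℕ}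
    (hσ : σ.Injective) {A : Set (ℕ → E)} (hA : MeasurableSet A) {f : (ℕ → E) → F}
    (hf : AEStronglyMeasurable f μ) :
    ∫ h in {h | h ∘ σ ∈ A}, f (h ∘ σ) ∂μ = ∫ h in A, f h ∂μ := by
  have hmap := (hμ σ hσ).map_eq
  nth_rw 2 [← hmap]
  rw [setIntegral_map hA (by rwa [hmap]) (hμ σ hσ).aemeasurable]
  rfl

theorem measurable_walk (t : ℕ) : Measurable fun h => walk h t :=
  Finset.measurable_sum _ fun a _ => measurable_pi_apply a

theorem measurable_chordSlope (i m : ℕ) : Measurable fun h => chordSlope h i m :=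
  ((measurable_walk _).sub (measurable_walk i)).div_const _

theorem measurableSet_isMinOn_tiltedWalk (i m : ℕ) (s : Set ℕ) (r : ℕ) :
    MeasurableSet {h | IsMinOn (tiltedWalk h (chordSlope h i m)) s r} := by
  have htilt (t : ℕ) : Measurable fun h => tiltedWalk h (chordSlope h i m) t :=
    (measurable_walk t).sub ((measurable_chordSlope i m).mul_const _)
  simp only [isMinOn_iff, Set.ofPred_forall]
  exact .iInter fun t => .iInter fun _ => measurableSet_le (htilt r) (htilt t)

theorem measurableSet_isFace (l i m : ℕ) : MeasurableSet {h | IsFace l h i m} :=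
  (MeasurableSet.const _).inter
    ((MeasurableSet.const _).inter (measurableSet_isMinOn_tiltedWalk i m _ i))

namespace IsExchangeable

variable {μ : Measure (ℕ → ℝ)} {f : ℝ → ℝ} {m : ℕ}

/-- By cyclic shifts, the `m` possible positions of the minimum of the bridge contribute equally. -/
theorem setIntegral_isMinOn_bridge (hμ : IsExchangeable μ) (hd : ∀ᵐ h ∂μ, DistinctSlopes h)
    (hm : 0 < m) (hf : Integrable (fun h => f (walk h m)) μ) :
    ∫ h in {h | IsMinOn (bridge h m) (Set.Iio m) 0}, f (walk h m) ∂μ =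
      (∫ h, f (walk h m) ∂μ) / m := by
  have hmeas (r : ℕ) : MeasurableSet {h | IsMinOn (bridge h m) (Set.Iio m) r} :=
    measurableSet_isMinOn_tiltedWalk 0 m _ r
  have hshift : ∀ r ∈ Finset.range m,
      ∫ h in {h | IsMinOn (bridge h m) (Set.Iio m) r}, f (walk h m) ∂μ =
        ∫ h in {h | IsMinOn (bridge h m) (Set.Iio m) 0}, f (walk h m) ∂μ := by
    intro r hr
    obtain ⟨q, rfl⟩ := Nat.exists_eq_add_of_lt (Finset.mem_range.1 hr)
    rw [← hμ.setIntegral_comp (blockSwap_injective r (q + 1)) (hmeas 0) hf.aestronglyMeasurable]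
    simp only [Set.mem_ofPred_eq, add_assoc, isMinOn_bridge_blockSwap_iff _ r q.succ_pos,
      walk_blockSwap_of_ge _ le_rfl]
  have hunique : ∀ᵐ h ∂μ, ∃! r, r ∈ Finset.range m ∧ IsMinOn (bridge h m) (Set.Iio m) r := by
    filter_upwards [hd] with h hd
    simpa only [Finset.coe_range] using existsUnique_isMinOn (Finset.nonempty_range_iff.2 hm.ne')
      (hd.injOn_bridge hm fun _ => by simp)
  have hsum := sum_setIntegral_of_existsUnique (fun r _ => hmeas r) hunique hf
  rw [Finset.sum_congr rfl hshift, Finset.sum_const, Finset.card_range, nsmul_eq_mul] at hsum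
  rw [← hsum, mul_div_cancel_left₀ _ (by positivity)]

theorem integrable_comp_walk_sub (hμ : IsExchangeable μ) (i : ℕ)
    (hf : Integrable (fun h => f (walk h m)) μ) :
    Integrable (fun h => f (walk h (i + m) - walk h i)) μ := by
  have := (hμ _ (blockSwap_injective i m)).integrable_comp_of_integrable hf
  refine this.congr (.of_forall fun h => ?_)
  simp only [Function.comp_apply, walk_blockSwap_of_le h le_rfl]

/-- Moving the block of a face to the front splits the face condition in two: the bridge of the
front block is minimal at its start, and the bridge is minimal among the later times at the former
position of the block. Almost surely exactly one later time minimizes the bridge, so the sum over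
`i` leaves only the first condition. -/
theorem sum_setIntegral_isFace (hμ : IsExchangeable μ) (hd : ∀ᵐ h ∂μ, DistinctSlopes h) {l : ℕ}
    (hm : m ∈ Finset.Icc 1 l) (hf : Integrable (fun h => f (walk h m)) μ) :
    ∑ i ∈ Finset.range l, ∫ h in {h | IsFace l h i m}, f (walk h (i + m) - walk h i) ∂μ =
      (∫ h, f (walk h m) ∂μ) / m := by
  obtain ⟨hm, hml⟩ := Finset.mem_Icc.1 hm
  let start : Set (ℕ → ℝ) := {h | IsMinOn (bridge h m) (Set.Iio m) 0}
  let position (i : ℕ) : Set (ℕ → ℝ) :=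
    {h | m + i ∈ Finset.Icc m l ∧ IsMinOn (bridge h m) (Finset.Icc m l) (m + i)}
  have hposition (i : ℕ) : MeasurableSet (position i) :=
    (MeasurableSet.const _).inter (measurableSet_isMinOn_tiltedWalk 0 m _ _)
  have hfront (i : ℕ) : ∫ h in {h | IsFace l h i m}, f (walk h (i + m) - walk h i) ∂μ =
      ∫ h in position i, f (walk h m) ∂(μ.restrict start) := by
    rw [← hμ.setIntegral_comp (blockSwap_injective m i) (measurableSet_isFace l i m)
      (hμ.integrable_comp_walk_sub i hf).aestronglyMeasurable,
      Measure.restrict_restrict (hposition i)]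
    simp only [walk_blockSwap_chord, Set.mem_ofPred_eq, isFace_blockSwap_iff _ hm]
    rw [Set.inter_comm]
    rfl
  have hunique : ∀ᵐ h ∂(μ.restrict start), ∃! i, i ∈ Finset.range l ∧ h ∈ position i := by
    filter_upwards [ae_restrict_of_ae hd] with h hd
    obtain ⟨j, ⟨hj, hmin⟩, huniq⟩ := existsUnique_isMinOn (Finset.nonempty_Icc.2 hml)
      (hd.injOn_bridge hm fun h0 => by
        rw [Finset.coe_Icc, Set.mem_Icc] at h0
        omega)
    obtain ⟨i, rfl⟩ := Nat.exists_eq_add_of_le (Finset.mem_Icc.1 hj).1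
    have hil : i < l := by rw [Finset.mem_Icc] at hj; omega
    exact ⟨i, ⟨Finset.mem_range.2 hil, hj, hmin⟩, fun i' hi' => Nat.add_left_cancel
      (huniq _ hi'.2)⟩
  rw [Finset.sum_congr rfl fun i _ => hfront i,
    sum_setIntegral_of_existsUnique (fun i _ => hposition i) hunique hf.restrict,
    hμ.setIntegral_isMinOn_bridge hd hm hf]

end IsExchangeable

theorem sum_faces_eq_sum_indicator (l : ℕ) (h : ℕ → ℝ) (φ : ℕ → ℝ → ℝ) :
    ∑ c ∈ faces l h, φ c.2 (walk h (c.1 + c.2) - walk h c.1) =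
      ∑ m ∈ Finset.Icc 1 l, ∑ i ∈ Finset.range l,
        {h | IsFace l h i m}.indicator (fun h => φ m (walk h (i + m) - walk h i)) h := by
  rw [faces, Finset.sum_filter, Finset.sum_product_right]
  rfl

section Spitzer

variable {μ : Measure (ℕ → ℝ)} {φ : ℕ → ℝ → ℝ} {l : ℕ}

theorem IsExchangeable.integrable_indicator_isFace (hμ : IsExchangeable μ)
    (hφ : ∀ m ∈ Finset.Icc 1 l, Integrable (fun h => φ m (walk h m)) μ) :
    ∀ m ∈ Finset.Icc 1 l, ∀ i ∈ Finset.range l, Integrable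
      ({h | IsFace l h i m}.indicator fun h => φ m (walk h (i + m) - walk h i)) μ :=
  fun m hm i _ => (hμ.integrable_comp_walk_sub i (hφ m hm)).indicator (measurableSet_isFace l i m)

theorem IsExchangeable.integrable_sum_faces (hμ : IsExchangeable μ)
    (hφ : ∀ m ∈ Finset.Icc 1 l, Integrable (fun h => φ m (walk h m)) μ) :
    Integrable (fun h => ∑ c ∈ faces l h, φ c.2 (walk h (c.1 + c.2) - walk h c.1)) μ := by
  simp only [sum_faces_eq_sum_indicator]
  exact integrable_finsetSum _ fun m hm => integrable_finsetSum _ fun i hi =>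
    hμ.integrable_indicator_isFace hφ m hm i hi

theorem IsExchangeable.integral_sum_faces (hμ : IsExchangeable μ)
    (hd : ∀ᵐ h ∂μ, DistinctSlopes h)
    (hφ : ∀ m ∈ Finset.Icc 1 l, Integrable (fun h => φ m (walk h m)) μ) :
    ∫ h, ∑ c ∈ faces l h, φ c.2 (walk h (c.1 + c.2) - walk h c.1) ∂μ =
      ∑ m ∈ Finset.Icc 1 l, (∫ h, φ m (walk h m) ∂μ) / m := by
  have hint := hμ.integrable_indicator_isFace hφ
  simp only [sum_faces_eq_sum_indicator]
  rw [integral_finsetSum _ fun m hm => integrable_finsetSum _ (hint m hm)]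
  refine Finset.sum_congr rfl fun m hm => ?_
  rw [integral_finsetSum _ (hint m hm), ← hμ.sum_setIntegral_isFace hd hm (hφ m hm)]
  exact Finset.sum_congr rfl fun i _ => integral_indicator (measurableSet_isFace l i m)

end Spitzer

end Exchangeable

section IndependentIncrements

theorem ae_ne_of_indepFun {Ω α : Type*} [MeasurableSpace Ω] [MeasurableSpace α] [MeasurableEq α]
    {μ : Measure Ω} [IsFiniteMeasure μ] {X Y : Ω → α} (hX : AEMeasurable X μ)
    (hY : AEMeasurable Y μ) (hXY : IndepFun X Y μ) [NullSingletonClass (μ.map Y)] :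
    ∀ᵐ ω ∂μ, X ω ≠ Y ω := by
  have hdiag : MeasurableSet {x : α × α | x.1 ≠ x.2} :=
    (measurableSet_eq_fun measurable_fst measurable_snd).compl
  rw [← ae_map_iff (hX.prodMk hY) hdiag,
    (indepFun_iff_map_prod_eq_prod_map_map hX hY).1 hXY, Measure.ae_prod_iff_ae_ae hdiag]
  refine .of_forall fun x => ?_
  rw [ae_iff]
  simpa only [ne_eq, not_not, Set.ofPred_eq_eq_singleton'] using measure_singleton x

variable {ι : Type*} (ν : Measure ℝ) [IsProbabilityMeasure ν]

theorem ae_sum_mul_ne_zero [NullSingletonClass ν] {s : Finset ι} {c : ι → ℝ} {a : ι} (ha : a ∈ s)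
    (hc : c a ≠ 0) : ∀ᵐ h ∂(Measure.infinitePi fun _ : ι => ν), ∑ x ∈ s, c x * h x ≠ 0 := by
  classical
  have heval := measurePreserving_eval_infinitePi (fun _ : ι => ν) a
  have : NullSingletonClass ((Measure.infinitePi fun _ : ι => ν).map fun h => h a) := by
    rwa [show (fun h : ι → ℝ => h a) = Function.eval a from rfl, heval.map_eq]
  have hterms : iIndepFun (fun x (h : ι → ℝ) => c x * h x) (Measure.infinitePi fun _ => ν) :=
    iIndepFun_infinitePi (P := fun _ : ι => ν) (X := fun x y => c x * y) fun x => by fun_prop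
  have hrest : IndepFun (fun h => -(∑ x ∈ s.erase a, c x * h x) / c a) (fun h => h a)
      (Measure.infinitePi fun _ => ν) := by
    have := (hterms.indepFun_finsetSum_of_notMem (fun x => by fun_prop) (s.notMem_erase a)).comp
      (φ := fun y => -y / c a) (ψ := fun y => y / c a)
      (measurable_neg.div_const _) (measurable_id.div_const _)
    refine this.congr (.of_forall fun h => ?_) (.of_forall fun h => ?_)
    · simp only [Function.comp_apply, Finset.sum_apply]
    · simp only [Function.comp_apply, mul_div_cancel_left₀ _ hc]
  filter_upwards [ae_ne_of_indepFun (Measurable.aemeasurable (by fun_prop))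
    (measurable_pi_apply a).aemeasurable hrest] with h hne hsum
  rw [← Finset.sum_erase_add s _ ha, add_comm, add_eq_zero_iff_eq_neg] at hsum
  rw [← hsum, mul_div_cancel_left₀ _ hc] at hne
  exact hne rfl

theorem measurePreserving_infinitePi_comp {ι κ E : Type*} [MeasurableSpace E] (ν : Measure E)
    [IsProbabilityMeasure ν] {f : κ → ι} (hf : f.Injective) :
    MeasurePreserving (fun (ω : ι → E) k => ω (f k)) (Measure.infinitePi fun _ => ν)
      (Measure.infinitePi fun _ => ν) :=
  ⟨by fun_prop, Measure.map_infinitePi_infinitePi_of_inj (P := fun _ => ν) hf⟩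

theorem isExchangeable_infinitePi {E : Type*} [MeasurableSpace E] (ν : Measure E)
    [IsProbabilityMeasure ν] : IsExchangeable (Measure.infinitePi fun _ : ℕ => ν) :=
  fun _ hσ => measurePreserving_infinitePi_comp ν hσ

/-- The coefficients of a chord slope as a linear function of the increments. -/
def chordWeight (i m : ℕ) : ℕ → ℝ := (Set.Ico i (i + m)).indicator fun _ => (m : ℝ)⁻¹

theorem chordSlope_eq_sum (h : ℕ → ℝ) {i m n : ℕ} (hn : i + m ≤ n) :
    chordSlope h i m = ∑ x ∈ Finset.range n, chordWeight i m x * h x := by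
  have hsub : Finset.Ico i (i + m) ⊆ Finset.range n := fun x hx => by
    simp only [Finset.mem_Ico, Finset.mem_range] at hx ⊢
    omega
  rw [chordSlope, walk, walk, ← Finset.sum_Ico_eq_sub h (by omega), div_eq_inv_mul,
    Finset.mul_sum, ← Finset.sum_subset hsub fun x _ hx => ?_]
  · exact Finset.sum_congr rfl fun x hx => by
      rw [chordWeight, Set.indicator_of_mem (by simpa using hx)]
  · rw [chordWeight, Set.indicator_of_notMem (by simpa using hx), zero_mul]

theorem chordWeight_injOn :
    Set.InjOn (fun c : ℕ × ℕ => chordWeight c.1 c.2) {c | 0 < c.2} := by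
  have support_eq {i m : ℕ} (hm : 0 < m) : (chordWeight i m).support = Set.Ico i (i + m) := by
    ext x
    simp [chordWeight, hm.ne']
  rintro ⟨i, m⟩ hm ⟨i', m'⟩ hm' heq
  simp only [Set.mem_ofPred_eq] at hm hm'
  have hIco : Set.Ico i (i + m) = Set.Ico i' (i' + m') := by
    rw [← support_eq hm, ← support_eq hm']
    exact congrArg _ heq
  have := (Set.Ico_eq_Ico_iff (Or.inl (by omega))).1 hIco
  rw [Prod.mk.injEq]
  omega

theorem ae_distinctSlopes [NullSingletonClass ν] :
    ∀ᵐ h ∂(Measure.infinitePi fun _ : ℕ => ν), DistinctSlopes h := by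
  have hpair (c c' : ℕ × ℕ) : ∀ᵐ h ∂(Measure.infinitePi fun _ : ℕ => ν), 0 < c.2 → 0 < c'.2 →
      chordSlope h c.1 c.2 = chordSlope h c'.1 c'.2 → c = c' := by
    by_cases hweight : chordWeight c.1 c.2 = chordWeight c'.1 c'.2
    · exact .of_forall fun h hc hc' _ => chordWeight_injOn hc hc' hweight
    · obtain ⟨x, hx⟩ := Function.ne_iff.1 hweight
      have hxn : x < max (c.1 + c.2) (c'.1 + c'.2) := by
        by_contra hge
        rw [not_lt, max_le_iff] at hge
        refine hx ?_
        rw [chordWeight, chordWeight, Set.indicator_of_notMem fun h => hge.1.not_gt h.2,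
          Set.indicator_of_notMem fun h => hge.2.not_gt h.2]
      filter_upwards [ae_sum_mul_ne_zero ν (c := fun x => chordWeight c.1 c.2 x -
        chordWeight c'.1 c'.2 x) (Finset.mem_range.2 hxn) (sub_ne_zero.2 hx)] with h hne _ _ heq
      rw [chordSlope_eq_sum h (le_max_left _ (c'.1 + c'.2)),
        chordSlope_eq_sum h (le_max_right (c.1 + c.2) _), ← sub_eq_zero,
        ← Finset.sum_sub_distrib] at heq
      simp only [sub_mul] at hne
      exact absurd heq hne
  filter_upwards [ae_all_iff.2 fun c => ae_all_iff.2 (hpair c)] with h hh c hc c' hc'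
  exact hh c c' hc hc'

section SecondMoment

variable {ν} (hν : MemLp id 2 ν)
include hν

theorem memLp_walk (m : ℕ) :
    MemLp (fun h => walk h m) 2 (Measure.infinitePi fun _ : ℕ => ν) :=
  memLp_finsetSum _ fun a _ =>
    hν.comp_measurePreserving (measurePreserving_eval_infinitePi (fun _ : ℕ => ν) a)

theorem integral_sq_walk (hmean : ∫ x, x ∂ν = 0) (m : ℕ) :
    ∫ h, walk h m ^ 2 ∂(Measure.infinitePi fun _ : ℕ => ν) = m * Var[id; ν] := by
  have hlaw (a : ℕ) : HasLaw (fun h : ℕ → ℝ => h a) ν (Measure.infinitePi fun _ => ν) :=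
    (measurePreserving_eval_infinitePi (fun _ : ℕ => ν) a).hasLaw
  have heval_memLp (a : ℕ) : MemLp (fun h : ℕ → ℝ => h a) 2 (Measure.infinitePi fun _ => ν) :=
    hν.comp_measurePreserving (measurePreserving_eval_infinitePi (fun _ : ℕ => ν) a)
  have hcentered : ∫ h, walk h m ∂(Measure.infinitePi fun _ : ℕ => ν) = 0 := by
    simp only [walk]
    rw [integral_finsetSum _ fun a _ => (heval_memLp a).integrable one_le_two]
    exact Finset.sum_eq_zero fun a _ => (hlaw a).integral_eq.trans hmean
  have hind : iIndepFun (fun a (h : ℕ → ℝ) => h a) (Measure.infinitePi fun _ => ν) :=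
    iIndepFun_infinitePi (P := fun _ : ℕ => ν) (X := fun _ y => y) fun _ => by fun_prop
  have hvar := IndepFun.variance_sum (s := Finset.range m) (fun a _ => heval_memLp a)
    fun a _ b _ hab => hind.indepFun hab
  rw [Finset.sum_congr rfl fun a _ => (hlaw a).variance_eq, Finset.sum_const, Finset.card_range,
    nsmul_eq_mul] at hvar
  rw [← hvar, ← variance_of_integral_eq_zero (measurable_walk m).aemeasurable hcentered]
  congr 1
  ext h
  simp only [walk, Finset.sum_apply]

end SecondMoment

theorem IsIsotonicRegression.sum_sq {l : ℕ} {h p : ℕ → ℝ} (H : IsIsotonicRegression l h p)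
    (hd : DistinctSlopes h) : ∑ t ∈ Finset.range l, p t ^ 2 =
      ∑ c ∈ faces l h, (walk h (c.1 + c.2) - walk h c.1) ^ 2 / (c.2 : ℝ) := by
  rw [H.sum_comp_eq_sum_faces hd (· ^ 2)]
  refine Finset.sum_congr rfl fun c hc => ?_
  have hpos : (0 : ℝ) < c.2 := by exact_mod_cast (mem_faces.1 hc).1
  rw [chordSlope]
  field_simp

section IsotonicRegression

variable [NullSingletonClass ν]
  {Ω : Type*} [MeasurableSpace Ω] {P : Measure Ω} {X p : Ω → ℕ → ℝ} {l : ℕ}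
  (hX : MeasurePreserving X P (Measure.infinitePi fun _ : ℕ => ν))
  (hp : ∀ ω, IsIsotonicRegression l (X ω) (p ω))
include hX hp

variable {ν}

theorem sum_sq_isotonicRegression_ae_eq :
    (fun ω => ∑ t ∈ Finset.range l, p ω t ^ 2) =ᵐ[P] (fun h => ∑ c ∈ faces l h,
      (walk h (c.1 + c.2) - walk h c.1) ^ 2 / (c.2 : ℝ)) ∘ X := by
  filter_upwards [hX.quasiMeasurePreserving.ae (ae_distinctSlopes ν)] with ω hd
  exact (hp ω).sum_sq hd

theorem integrable_sum_sq_isotonicRegression (hν : MemLp id 2 ν) :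
    Integrable (fun ω => ∑ t ∈ Finset.range l, p ω t ^ 2) P := by
  refine Integrable.congr ?_ (sum_sq_isotonicRegression_ae_eq hX hp).symm
  exact hX.integrable_comp_of_integrable ((isExchangeable_infinitePi ν).integrable_sum_faces
    (φ := fun m r => r ^ 2 / m) fun m _ => (memLp_walk hν m).integrable_sq.div_const _)

theorem integral_sum_sq_isotonicRegression (hν : MemLp id 2 ν) (hmean : ∫ x, x ∂ν = 0) :
    ∫ ω, ∑ t ∈ Finset.range l, p ω t ^ 2 ∂P = harmonic l * Var[id; ν] := by
  have hint (m : ℕ) : Integrable (fun h => walk h m ^ 2 / m) (Measure.infinitePi fun _ => ν) :=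
    (memLp_walk hν m).integrable_sq.div_const _
  have hexch := isExchangeable_infinitePi ν
  have hfaces := hexch.integrable_sum_faces (l := l) (φ := fun m r => r ^ 2 / m) fun m _ => hint m
  rw [integral_congr_ae (sum_sq_isotonicRegression_ae_eq hX hp),
    hX.hasLaw.integral_comp hfaces.aestronglyMeasurable,
    hexch.integral_sum_faces (φ := fun m r => r ^ 2 / m) (ae_distinctSlopes ν) fun m _ => hint m,
    harmonic_eq_sum_Icc]
  push_cast
  rw [Finset.sum_mul]
  refine Finset.sum_congr rfl fun m hm => ?_
  have hpos : (0 : ℝ) < m := by exact_mod_cast (Finset.mem_Icc.1 hm).1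
  rw [integral_div, integral_sq_walk hν hmean]
  field_simp

end IsotonicRegression

end IndependentIncrements

section MetricProjection

variable {E : Type*} [NormedAddCommGroup E] [InnerProductSpace ℝ E] [CompleteSpace E]

section Convex

variable {C : Set E} (hne : C.Nonempty) (hcl : IsClosed C) (hco : Convex ℝ C)
include hne hcl hco

theorem isNearestPoint_metricProj (g : E) : IsNearestPoint C g (metricProj C g) :=
  (isNearestPoint_iff_eq_metricProj hne hcl hco g _).2 rfl

theorem inner_sub_metricProj_sub_nonpos (g : E) {q : E} (hq : q ∈ C) :
    inner ℝ (g - metricProj C g) (q - metricProj C g) ≤ 0 := by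
  have hproj := isNearestPoint_metricProj hne hcl hco g
  have : Nonempty C := hne.to_subtype
  refine (norm_eq_iInf_iff_real_inner_le_zero hco hproj.1).1 ?_ q hq
  refine le_antisymm (le_ciInf fun w => hproj.2 w w.2) ?_
  exact ciInf_le ⟨0, Set.forall_mem_range.2 fun _ => norm_nonneg _⟩ (⟨_, hproj.1⟩ : C)

theorem lipschitzWith_metricProj : LipschitzWith 1 (metricProj C) := by
  refine LipschitzWith.of_dist_le_mul fun g h => ?_
  rw [NNReal.coe_one, one_mul, dist_eq_norm, dist_eq_norm]
  set p := metricProj C g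
  set q := metricProj C h
  have hg : inner ℝ (g - p) (q - p) ≤ 0 :=
    inner_sub_metricProj_sub_nonpos hne hcl hco g (isNearestPoint_metricProj hne hcl hco h).1
  have hh : inner ℝ (h - q) (p - q) ≤ 0 :=
    inner_sub_metricProj_sub_nonpos hne hcl hco h (isNearestPoint_metricProj hne hcl hco g).1
  have hsq : ‖p - q‖ * ‖p - q‖ ≤ ‖g - h‖ * ‖p - q‖ :=
    calc ‖p - q‖ * ‖p - q‖ = inner ℝ (p - q) (p - q) := (real_inner_self_eq_norm_mul_norm _).symm
      _ = inner ℝ (g - h) (p - q) + inner ℝ (g - p) (q - p) + inner ℝ (h - q) (p - q) := by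
        rw [← neg_sub p q, inner_neg_right, ← sub_eq_add_neg, ← inner_sub_left, ← inner_add_left]
        congr 1
        abel
      _ ≤ inner ℝ (g - h) (p - q) := by linarith
      _ ≤ ‖g - h‖ * ‖p - q‖ := real_inner_le_norm _ _
  rcases (norm_nonneg (p - q)).eq_or_lt with hzero | hpos
  · exact hzero ▸ norm_nonneg _
  · exact le_of_mul_le_mul_right hsq hpos

end Convex

variable (C : ProperCone ℝ E) (g : E)

theorem metricProj_mem_properCone : metricProj (C : Set E) g ∈ C :=
  (isNearestPoint_metricProj C.nonempty C.isClosed C.convex g).1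

theorem inner_sub_metricProj_nonpos {q : E} (hq : q ∈ C) :
    inner ℝ (g - metricProj (C : Set E) g) q ≤ 0 := by
  have := inner_sub_metricProj_sub_nonpos C.nonempty C.isClosed C.convex g
    (C.toSubmodule.add_mem hq (metricProj_mem_properCone C g))
  rwa [add_sub_cancel_right] at this

theorem inner_sub_metricProj_self :
    inner ℝ (g - metricProj (C : Set E) g) (metricProj (C : Set E) g) = 0 := by
  refine (inner_sub_metricProj_nonpos C g (metricProj_mem_properCone C g)).antisymm ?_
  have := inner_sub_metricProj_sub_nonpos C.nonempty C.isClosed C.convex g C.toSubmodule.zero_mem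
  rwa [zero_sub, inner_neg_right, neg_nonpos] at this

end MetricProjection

section Blocks

variable {V : Type*} [AddCommGroup V] (S : Finset V) (e : V)

/-- The number of steps `e` from `s` to the next element of `S`. -/
def blockLength (s : V) : ℕ := sInf {l | 1 ≤ l ∧ s + l • e ∈ S}

/-- The number of steps `e` back from `y` to the previous element of `S`, which is `y` itself
if `y ∈ S`. -/
def blockOffset (y : V) : ℕ := sInf {t | y - t • e ∈ S}

variable {S e} {s y : V} {t : ℕ}

theorem sub_blockOffset_mem (hy : ∃ t : ℕ, y - t • e ∈ S) : y - blockOffset S e y • e ∈ S :=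
  Nat.sInf_mem hy

theorem add_nsmul_sub_nsmul {u : ℕ} (h : u ≤ t) : s + t • e - u • e = s + (t - u) • e := by
  rw [sub_nsmul e h, ← sub_eq_add_neg, add_sub_assoc]

section Finite

variable [Finite V]

theorem lt_blockLength_iff (hs : s ∈ S) :
    t < blockLength S e s ↔ ∀ u, 1 ≤ u → u ≤ t → s + u • e ∉ S := by
  have hmem : blockLength S e s ∈ {l | 1 ≤ l ∧ s + l • e ∈ S} :=
    Nat.sInf_mem ⟨addOrderOf e, addOrderOf_pos e, by rwa [addOrderOf_nsmul_eq_zero, add_zero]⟩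
  constructor
  · intro hlt u hu hut hmem_u
    exact (hut.trans_lt hlt).not_ge (Nat.sInf_le ⟨hu, hmem_u⟩)
  · intro h
    by_contra! hle
    exact h _ hmem.1 hle hmem.2

theorem blockOffset_lt (hy : ∃ t : ℕ, y - t • e ∈ S) :
    blockOffset S e y < blockLength S e (y - blockOffset S e y • e) := by
  rw [lt_blockLength_iff (sub_blockOffset_mem hy)]
  intro u hu hle hmem
  have hback : y - blockOffset S e y • e + u • e = y - (blockOffset S e y - u) • e := by
    rw [sub_nsmul e hle]
    abel
  rw [hback] at hmem
  have : blockOffset S e y ≤ blockOffset S e y - u := Nat.sInf_le hmem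
  omega

theorem blockOffset_add (hs : s ∈ S) (ht : t < blockLength S e s) :
    blockOffset S e (s + t • e) = t := by
  have hmem : s + t • e - t • e ∈ S := by rwa [add_sub_cancel_right]
  have hle : blockOffset S e (s + t • e) ≤ t := Nat.sInf_le hmem
  by_contra hne
  have hprev := sub_blockOffset_mem ⟨t, hmem⟩
  rw [add_nsmul_sub_nsmul hle] at hprev
  exact (lt_blockLength_iff hs).1 ht _ (by omega) (by omega) hprev

end Finite

theorem sum_eq_sum_blocks [Fintype V] {M : Type*} [AddCommMonoid M]
    (hS : ∀ y, ∃ t : ℕ, y - t • e ∈ S) (f : V → M) :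
    ∑ y, f y = ∑ s ∈ S, ∑ t ∈ Finset.range (blockLength S e s), f (s + t • e) := by
  rw [Finset.sum_sigma']
  symm
  refine Finset.sum_bij' (fun p _ => p.1 + p.2 • e)
    (fun y _ => ⟨y - blockOffset S e y • e, blockOffset S e y⟩) ?_ ?_ ?_ ?_ ?_
  · simp
  · intro y _
    simpa using ⟨sub_blockOffset_mem (hS y), blockOffset_lt (hS y)⟩
  · rintro ⟨s, t⟩ hp
    simp only [Finset.mem_sigma, Finset.mem_range] at hp
    simp [blockOffset_add hp.1 hp.2]
  · simp
  · simp

end Blocks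

section CyclicCone

variable {V : Type*} [AddCommGroup V] {S : Finset V} {e : V}

/-- The signals on `V` that increase along every step from `i - e` to `i` with `i ∉ S`. -/
def cyclicCone (S : Finset V) (e : V) : ProperCone ℝ (EuclideanSpace ℝ V) where
  carrier := {y | ∀ i ∉ S, y (i - e) ≤ y i}
  add_mem' hy hz i hi := add_le_add (hy i hi) (hz i hi)
  zero_mem' _ _ := le_rfl
  smul_mem' c _ hy i hi := mul_le_mul_of_nonneg_left (hy i hi) c.2
  isClosed' := by
    simp only [Set.ofPred_forall]
    exact isClosed_iInter fun i => isClosed_iInter fun _ =>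
      isClosed_le (by fun_prop) (by fun_prop)

theorem mem_cyclicCone {y : EuclideanSpace ℝ V} :
    y ∈ cyclicCone S e ↔ ∀ i ∉ S, y (i - e) ≤ y i := Iff.rfl

open Classical in
/-- The signal that takes the values of `q` along the block that starts at `s` and vanishes on all
other blocks. -/
def blockExtension (S : Finset V) (e s : V) (q : ℕ → ℝ) : EuclideanSpace ℝ V :=
  WithLp.toLp 2 fun y =>
    if y - blockOffset S e y • e = s then q (blockOffset S e y) else 0

section Finite

variable [Finite V]

theorem mem_cyclicCone_iff_monotoneOn (hS : ∀ y, ∃ t : ℕ, y - t • e ∈ S)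
    {q : EuclideanSpace ℝ V} : q ∈ cyclicCone S e ↔
      ∀ s ∈ S, MonotoneOn (fun t : ℕ => q (s + t • e)) (Set.Iio (blockLength S e s)) := by
  rw [mem_cyclicCone]
  constructor
  · intro hq s hs
    refine monotoneOn_of_le_add_one Set.ordConnected_Iio fun t _ _ ht => ?_
    have hstep := hq _ ((lt_blockLength_iff hs).1 ht (t + 1) (by omega) le_rfl)
    rwa [add_nsmul, one_nsmul, ← add_assoc, add_sub_cancel_right, add_assoc,
      ← succ_nsmul] at hstep
  · intro hq i hi
    obtain ⟨t, ht⟩ : ∃ t, blockOffset S e i = t + 1 := by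
      refine Nat.exists_eq_succ_of_ne_zero fun hzero => hi ?_
      simpa [hzero] using sub_blockOffset_mem (hS i)
    have hlt := blockOffset_lt (hS i)
    have hmono := hq _ (sub_blockOffset_mem (hS i)) (Set.mem_Iio.2 ((by omega : t < _).trans hlt))
      hlt (by omega)
    have hprev : i - blockOffset S e i • e + t • e = i - e := by
      rw [ht, succ_nsmul]
      abel
    simpa only [hprev, sub_add_cancel] using hmono

theorem blockExtension_apply (s : V) (q : ℕ → ℝ) {s' : V} (hs' : s' ∈ S) {t : ℕ}
    (ht : t < blockLength S e s') [Decidable (s' = s)] :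
    blockExtension S e s q (s' + t • e) = if s' = s then q t else 0 := by
  simp only [blockExtension, blockOffset_add hs' ht, add_sub_cancel_right]

theorem blockExtension_mem (hS : ∀ y, ∃ t : ℕ, y - t • e ∈ S) {s : V} {q : ℕ → ℝ}
    (hq : MonotoneOn q (Set.Iio (blockLength S e s))) :
    blockExtension S e s q ∈ cyclicCone S e := by
  classical
  refine (mem_cyclicCone_iff_monotoneOn hS).2 fun s' hs' t ht u hu htu => ?_
  simp only [blockExtension_apply s q hs' ht, blockExtension_apply s q hs' hu]
  split_ifs with heq
  · subst heq
    exact hq ht hu htu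
  · exact le_rfl

end Finite

variable [Fintype V] (hS : ∀ y, ∃ t : ℕ, y - t • e ∈ S)
include hS

theorem inner_eq_sum_blocks (p q : EuclideanSpace ℝ V) : inner ℝ p q =
    ∑ s ∈ S, ∑ t ∈ Finset.range (blockLength S e s), p (s + t • e) * q (s + t • e) := by
  rw [PiLp.inner_apply, sum_eq_sum_blocks hS]
  simp only [RCLike.inner_apply', conj_trivial]

theorem inner_blockExtension (p : EuclideanSpace ℝ V) {s : V} (hs : s ∈ S) (q : ℕ → ℝ) :
    inner ℝ p (blockExtension S e s q) =
      ∑ t ∈ Finset.range (blockLength S e s), p (s + t • e) * q t := by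
  classical
  rw [inner_eq_sum_blocks hS, Finset.sum_eq_single_of_mem s hs]
  · refine Finset.sum_congr rfl fun t ht => ?_
    rw [blockExtension_apply s q hs (Finset.mem_range.1 ht), if_pos rfl]
  · refine fun s' hs' hne => Finset.sum_eq_zero fun t ht => ?_
    rw [blockExtension_apply s q hs' (Finset.mem_range.1 ht), if_neg hne, mul_zero]

theorem isIsotonicRegression_metricProj_cyclicCone (g : EuclideanSpace ℝ V) {s : V} (hs : s ∈ S) :
    IsIsotonicRegression (blockLength S e s) (fun t => g (s + t • e))
      fun t => metricProj (cyclicCone S e : Set (EuclideanSpace ℝ V)) g (s + t • e) := by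
  set p := metricProj (cyclicCone S e : Set (EuclideanSpace ℝ V)) g
  have hmono := (mem_cyclicCone_iff_monotoneOn hS).1 (metricProj_mem_properCone (cyclicCone S e) g)
  have hnonpos {s : V} (hs : s ∈ S) (q : ℕ → ℝ) (hq : MonotoneOn q (Set.Iio (blockLength S e s))) :
      ∑ t ∈ Finset.range (blockLength S e s), (g - p) (s + t • e) * q t ≤ 0 := by
    rw [← inner_blockExtension hS _ hs]
    exact inner_sub_metricProj_nonpos _ g (blockExtension_mem hS hq)
  refine ⟨hmono s hs, ?_, hnonpos hs⟩
  have htotal := inner_sub_metricProj_self (cyclicCone S e) g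
  rw [inner_eq_sum_blocks hS] at htotal
  exact (Finset.sum_eq_zero_iff_of_nonpos fun s hs => hnonpos hs _ (hmono s hs)).1 htotal s hs

theorem sum_blockLength : ∑ s ∈ S, blockLength S e s = Fintype.card V := by
  have := sum_eq_sum_blocks hS fun _ => 1
  simpa using this.symm

end CyclicCone

theorem IsIsotonicRegression.congr_left {l : ℕ} {h h' p : ℕ → ℝ} (H : IsIsotonicRegression l h p)
    (heq : ∀ t < l, h t = h' t) : IsIsotonicRegression l h' p := by
  have hsum (q : ℕ → ℝ) : ∑ t ∈ Finset.range l, (h' t - p t) * q t =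
      ∑ t ∈ Finset.range l, (h t - p t) * q t :=
    Finset.sum_congr rfl fun t ht => by rw [heq t (Finset.mem_range.1 ht)]
  exact ⟨H.monotoneOn, (hsum p).trans H.sum_mul_self, fun q hq =>
    (hsum q).trans_le (H.sum_mul_nonpos q hq)⟩

section StatisticalDimension

variable {V : Type*}

theorem measurePreserving_infinitePi_stdGaussian {ι : Type*} [Fintype V] {f : V → ι}
    (hf : f.Injective) :
    MeasurePreserving (fun (ω : ι → ℝ) => (WithLp.toLp 2 fun v => ω (f v) : EuclideanSpace ℝ V))
      (Measure.infinitePi fun _ => gaussianReal 0 1) (stdGaussian (EuclideanSpace ℝ V)) := by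
  have htoLp : MeasurePreserving (WithLp.toLp 2) (Measure.infinitePi fun _ => gaussianReal 0 1)
      (stdGaussian (EuclideanSpace ℝ V)) :=
    ⟨by fun_prop, by rw [Measure.infinitePi_eq_pi, map_pi_eq_stdGaussian]⟩
  exact htoLp.comp (measurePreserving_infinitePi_comp (gaussianReal 0 1) hf)

/-- The first `l` terms of `f`, continued by fresh indices. -/
def extendByFresh (l : ℕ) (f : ℕ → V) (t : ℕ) : V ⊕ ℕ := if t < l then Sum.inl (f t) else Sum.inr t

theorem extendByFresh_injective {l : ℕ} {f : ℕ → V} (hf : Set.InjOn f (Set.Iio l)) :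
    (extendByFresh l f).Injective := by
  intro t u htu
  unfold extendByFresh at htu
  split_ifs at htu with ht hu
  · exact hf ht hu (Sum.inl_injective htu)
  · exact Sum.inr_injective htu

variable [AddCommGroup V] {S : Finset V} {e : V}

theorem injOn_block [Finite V] {s : V} (hs : s ∈ S) :
    Set.InjOn (fun t : ℕ => s + t • e) (Set.Iio (blockLength S e s)) := by
  intro t ht u hu htu
  rw [← blockOffset_add hs ht, ← blockOffset_add hs hu]
  exact congrArg (blockOffset S e) htu

theorem integral_norm_sq_metricProj_cyclicCone [Fintype V] (hS : ∀ y, ∃ t : ℕ, y - t • e ∈ S) :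
    ∫ g, ‖metricProj (cyclicCone S e : Set (EuclideanSpace ℝ V)) g‖ ^ 2
      ∂(stdGaussian (EuclideanSpace ℝ V)) = ∑ s ∈ S, (harmonic (blockLength S e s) : ℝ) := by
  set C := cyclicCone S e
  set G : (V ⊕ ℕ → ℝ) → EuclideanSpace ℝ V := fun ω => WithLp.toLp 2 fun v => ω (Sum.inl v)
  have hG := measurePreserving_infinitePi_stdGaussian (Sum.inl_injective (α := V) (β := ℕ))
  have hcont : Continuous (metricProj (C : Set (EuclideanSpace ℝ V))) :=
    (lipschitzWith_metricProj C.nonempty C.isClosed C.convex).continuous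
  let γ : Measure (ℕ → ℝ) := Measure.infinitePi fun _ => gaussianReal 0 1
  let X (s : V) (ω : V ⊕ ℕ → ℝ) (t : ℕ) : ℝ :=
    ω (extendByFresh (blockLength S e s) (fun t => s + t • e) t)
  have hX {s : V} (hs : s ∈ S) : MeasurePreserving (X s)
      (Measure.infinitePi fun _ => gaussianReal 0 1) γ :=
    measurePreserving_infinitePi_comp _ (extendByFresh_injective (injOn_block hs))
  have hreg {s : V} (hs : s ∈ S) (ω : V ⊕ ℕ → ℝ) : IsIsotonicRegression (blockLength S e s) (X s ω)
      fun t => metricProj (C : Set (EuclideanSpace ℝ V)) (G ω) (s + t • e) :=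
    (isIsotonicRegression_metricProj_cyclicCone hS (G ω) hs).congr_left fun t ht => by
      simp only [X, G, extendByFresh, if_pos ht]
  have : NullSingletonClass (gaussianReal 0 1) := nullSingletonClass_gaussianReal one_ne_zero
  have hmemLp : MemLp id 2 (gaussianReal 0 1) := memLp_id_gaussianReal 2
  rw [← hG.hasLaw.integral_comp (by fun_prop)]
  simp only [Function.comp_def, EuclideanSpace.real_norm_sq_eq, sum_eq_sum_blocks hS]
  rw [integral_finsetSum _ fun s hs =>
    integrable_sum_sq_isotonicRegression (hX hs) (hreg hs) hmemLp]
  refine Finset.sum_congr rfl fun s hs => ?_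
  rw [integral_sum_sq_isotonicRegression (hX hs) (hreg hs) hmemLp integral_id_gaussianReal,
    variance_id_gaussianReal, NNReal.coe_one, mul_one]

end StatisticalDimension

section DescentCone

variable {M : ℕ}

theorem fin_succ_sub_one (i : Fin M) : i.succ - 1 = i.castSucc := by
  rw [sub_eq_iff_eq_add, Fin.coeSucc_eq_succ]

theorem fin_zero_sub_one (M : ℕ) : (0 : Fin (M + 1)) - 1 = Fin.last M := by
  rw [sub_eq_iff_eq_add, Fin.last_add_one]

theorem fin_val_nsmul_one (t : ℕ) : ((t • 1 : Fin (M + 1)) : ℕ) = t % (M + 1) := by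
  open scoped Fin.CommRing in rw [nsmul_one, Fin.val_natCast]

theorem zero_notMem_changePoints (x : EuclideanSpace ℝ (Fin (M + 1))) :
    0 ∉ changePoints x := by
  simp [changePoints]

theorem succ_mem_changePoints_iff {x : EuclideanSpace ℝ (Fin (M + 1))} {i : Fin M} :
    i.succ ∈ changePoints x ↔ x i.castSucc < x i.succ := by
  simp only [changePoints, Finset.mem_filter, Finset.mem_univ, true_and]
  constructor
  · rintro ⟨j, hj, hlt⟩
    obtain rfl : j = i.castSucc := by ext; simpa using hj
    exact hlt
  · exact fun hlt => ⟨i.castSucc, by simp, hlt⟩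

theorem mem_cyclicCone_changePoints {x y : EuclideanSpace ℝ (Fin (M + 1))} :
    y ∈ cyclicCone (changePoints x) 1 ↔ y (Fin.last M) ≤ y 0 ∧
      ∀ i : Fin M, x i.succ ≤ x i.castSucc → y i.castSucc ≤ y i.succ := by
  rw [mem_cyclicCone, Fin.forall_fin_succ]
  simp only [fin_zero_sub_one, zero_notMem_changePoints, not_false_eq_true, forall_const,
    succ_mem_changePoints_iff, not_lt, fin_succ_sub_one]

theorem monotoneTV_le_iff {x z : EuclideanSpace ℝ (Fin (M + 1))} (hx : Monotone fun i => x i) :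
    monotoneTV (M + 1) z ≤ monotoneTV (M + 1) x ↔
      Monotone (fun i => z i) ∧ z (Fin.last M) - z 0 ≤ x (Fin.last M) - x 0 := by
  simp only [monotoneTV, if_pos hx]
  split_ifs with hz
  · simp only [EReal.coe_le_coe_iff, hz, true_and]
  · simp only [hz, false_and, iff_false, top_le_iff]
    exact EReal.coe_ne_top _

theorem mem_descentCone_monotoneTV {x y : EuclideanSpace ℝ (Fin (M + 1))}
    (hx : Monotone fun i => x i) : y ∈ descentCone (monotoneTV (M + 1)) x ↔
      ∃ τ > (0 : ℝ), (∀ i : Fin M, x i.castSucc + τ * y i.castSucc ≤ x i.succ + τ * y i.succ) ∧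
        y (Fin.last M) ≤ y 0 := by
  simp only [descentCone, Set.mem_iUnion, Set.mem_Ioi, Set.mem_ofPred_eq, exists_prop,
    monotoneTV_le_iff hx, Fin.monotone_iff_le_succ, PiLp.add_apply, PiLp.smul_apply, smul_eq_mul]
  refine exists_congr fun τ => and_congr_right fun hτ => and_congr_right fun _ => ?_
  rw [← mul_le_mul_iff_right₀ hτ (b := y (Fin.last M))]
  constructor <;> intro h <;> linarith

theorem exists_pos_forall_mul_le {ι : Type*} [Finite ι] {a b : ι → ℝ} (hb : ∀ i, 0 ≤ b i)
    (ha : ∀ i, b i = 0 → a i ≤ 0) : ∃ τ > (0 : ℝ), ∀ i, τ * a i ≤ b i := by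
  have hev : ∀ᶠ τ in 𝓝[>] (0 : ℝ), ∀ i, τ * a i ≤ b i := by
    refine eventually_all.2 fun i => ?_
    rcases (hb i).eq_or_lt with hzero | hpos
    · filter_upwards [self_mem_nhdsWithin] with τ hτ
      rw [← hzero]
      exact mul_nonpos_of_nonneg_of_nonpos (le_of_lt hτ) (ha i hzero.symm)
    · have hlim : Tendsto (fun τ : ℝ => τ * a i) (𝓝[>] 0) (𝓝 (0 * a i)) :=
        (tendsto_id.mono_left nhdsWithin_le_nhds).mul_const _
      rw [zero_mul] at hlim
      exact (hlim.eventually_lt_const hpos).mono fun _ h => h.le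
  obtain ⟨τ, hle, hτ⟩ := (hev.and self_mem_nhdsWithin).exists
  exact ⟨τ, hτ, hle⟩

theorem descentCone_monotoneTV_eq {x : EuclideanSpace ℝ (Fin (M + 1))}
    (hx : Monotone fun i => x i) :
    descentCone (monotoneTV (M + 1)) x = cyclicCone (changePoints x) 1 := by
  ext y
  rw [mem_descentCone_monotoneTV hx, SetLike.mem_coe, mem_cyclicCone_changePoints]
  constructor
  · rintro ⟨τ, hτ, hmono, hends⟩
    refine ⟨hends, fun i hflat => le_of_mul_le_mul_left ?_ hτ⟩
    linarith [hmono i]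
  · rintro ⟨hends, hmono⟩
    obtain ⟨τ, hτ, hle⟩ := exists_pos_forall_mul_le
      (a := fun i : Fin M => y i.castSucc - y i.succ) (b := fun i => x i.succ - x i.castSucc)
      (fun i => sub_nonneg.2 (hx (Fin.castSucc_le_succ i)))
      (fun i hflat => sub_nonpos.2 (hmono i (sub_eq_zero.1 hflat).le))
    exact ⟨τ, hτ, fun i => by linarith [hle i], hends⟩

theorem exists_sub_nsmul_one_mem {S : Finset (Fin (M + 1))} (hS : S.Nonempty) (y : Fin (M + 1)) :
    ∃ t : ℕ, y - t • 1 ∈ S := by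
  obtain ⟨s, hs⟩ := hS
  refine ⟨(y - s : Fin (M + 1)), ?_⟩
  have hsteps : ((y - s : Fin (M + 1)) : ℕ) • (1 : Fin (M + 1)) = y - s :=
    Fin.ext (by rw [fin_val_nsmul_one, Nat.mod_eq_of_lt (Fin.is_lt _)])
  rwa [hsteps, sub_sub_cancel]

theorem statDim_descentCone_monotoneTV {x : EuclideanSpace ℝ (Fin (M + 1))}
    (hx : Monotone fun i => x i) (hne : (changePoints x).Nonempty) :
    statDim (descentCone (monotoneTV (M + 1)) x) =
      ∑ s ∈ changePoints x, (harmonic (blockLength (changePoints x) 1 s) : ℝ) := by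
  rw [statDim, descentCone_monotoneTV_eq hx]
  exact integral_norm_sq_metricProj_cyclicCone (exists_sub_nsmul_one_mem hne)

end DescentCone

section LongBlocks

variable {V : Type*} [AddCommGroup V]

/-- The starting points of the blocks with more than `j` elements. -/
def longBlocks (S : Finset V) (e : V) (j : ℕ) : Finset V := {s ∈ S | j < blockLength S e s}

variable [Fintype V] {S : Finset V} {e : V} (hS : ∀ y, ∃ t : ℕ, y - t • e ∈ S)
include hS

theorem succ_mul_card_longBlocks_le (j : ℕ) :
    (j + 1) * (longBlocks S e j).card ≤ Fintype.card V :=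
  calc (j + 1) * (longBlocks S e j).card = ∑ _s ∈ longBlocks S e j, (j + 1) := by
        rw [Finset.sum_const, smul_eq_mul, mul_comm]
    _ ≤ ∑ s ∈ longBlocks S e j, blockLength S e s :=
        Finset.sum_le_sum fun _ hs => (Finset.mem_filter.1 hs).2
    _ ≤ ∑ s ∈ S, blockLength S e s := Finset.sum_le_sum_of_subset (Finset.filter_subset _ _)
    _ = Fintype.card V := sum_blockLength hS

theorem sum_harmonic_blockLength : ∑ s ∈ S, (harmonic (blockLength S e s) : ℝ) =
    ∑ j ∈ Finset.range (Fintype.card V), ((longBlocks S e j).card : ℝ) / (j + 1) := by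
  have hle (s) (hs : s ∈ S) : blockLength S e s ≤ Fintype.card V :=
    (Finset.single_le_sum_of_canonicallyOrdered hs).trans_eq (sum_blockLength hS)
  have hharmonic (s) (hs : s ∈ S) : (harmonic (blockLength S e s) : ℝ) =
      ∑ j ∈ Finset.range (Fintype.card V),
        if j < blockLength S e s then 1 / ((j : ℝ) + 1) else 0 := by
    rw [← Finset.sum_filter, harmonic]
    push_cast
    refine Finset.sum_congr ?_ fun _ _ => (one_div _).symm
    ext j
    simp only [Finset.mem_range, Finset.mem_filter]
    exact ⟨fun hj => ⟨hj.trans_le (hle s hs), hj⟩, And.right⟩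
  rw [Finset.sum_congr rfl hharmonic, Finset.sum_comm]
  refine Finset.sum_congr rfl fun j _ => ?_
  rw [← Finset.sum_filter, Finset.sum_const, nsmul_eq_mul, mul_one_div, longBlocks]

end LongBlocks

section Counting

variable {M : ℕ}

theorem possibleChangePoints_succ : possibleChangePoints (M + 1) = Finset.Ioi 0 := by
  ext i
  simp [possibleChangePoints, Fin.pos_iff_ne_zero]

theorem card_possibleChangePoints_succ : (possibleChangePoints (M + 1)).card = M := by
  rw [possibleChangePoints_succ, Fin.card_Ioi]
  simp

theorem card_filter_mem_disjoint_powersetCard {α : Type*} [DecidableEq α] {P T : Finset α} {s : α}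
    (hT : T ⊆ P) (hs : s ∈ P) (hsT : s ∉ T) (k : ℕ) :
    {S ∈ P.powersetCard k | s ∈ S ∧ Disjoint T S}.card + (P.card - T.card - 1).choose k =
      (P.card - T.card).choose k := by
  have hmem : {S ∈ P.powersetCard k | s ∈ S ∧ Disjoint T S} =
      {S ∈ (P \ T).powersetCard k | s ∈ S} := by
    ext S
    simp only [Finset.mem_filter, Finset.mem_powersetCard, Finset.subset_sdiff, disjoint_comm]
    tauto
  have hnotMem : ((P \ T).erase s).powersetCard k = {S ∈ (P \ T).powersetCard k | s ∉ S} := by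
    ext S
    simp only [Finset.mem_filter, Finset.mem_powersetCard, Finset.subset_erase]
    tauto
  rw [← Finset.card_sdiff_of_subset hT, ← Finset.card_erase_of_mem (Finset.mem_sdiff.2 ⟨hs, hsT⟩),
    ← Finset.card_powersetCard, ← Finset.card_powersetCard, hmem, hnotMem,
    Finset.card_filter_add_card_filter_not]

theorem mem_longBlocks_one_iff {S : Finset (Fin (M + 1))} {s b : Fin (M + 1)} (hsb : s ≤ b) :
    s ∈ longBlocks S 1 (b - s : ℕ) ↔ s ∈ S ∧ Disjoint (Finset.Ioc s b) S := by
  rw [longBlocks, Finset.mem_filter]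
  refine and_congr_right fun hs => ?_
  have hcast (u : ℕ) (hu : u ≤ (b - s : ℕ)) : ((s + u • 1 : Fin (M + 1)) : ℕ) = s + u := by
    rw [Fin.val_add, fin_val_nsmul_one, Nat.add_mod_mod, Nat.mod_eq_of_lt (by omega)]
  rw [lt_blockLength_iff hs, Finset.disjoint_left]
  constructor
  · intro hfree i hi hiS
    obtain ⟨hsi, hib⟩ := Finset.mem_Ioc.1 hi
    refine hfree (i - s : ℕ) (by omega) (by omega) ?_
    convert hiS
    ext
    rw [hcast _ (by omega)]
    omega
  · intro hdisj u hu hub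
    refine hdisj (Finset.mem_Ioc.2 ⟨?_, ?_⟩)
    · rw [Fin.lt_def, hcast u hub]; omega
    · rw [Fin.le_def, hcast u hub]; omega

theorem card_filter_mem_longBlocks {s : Fin (M + 1)} (hs : 0 < s) {j : ℕ} (hsj : s + j ≤ M)
    (k : ℕ) :
    {S ∈ (possibleChangePoints (M + 1)).powersetCard k | s ∈ longBlocks S 1 j}.card +
      (M - j - 1).choose k = (M - j).choose k := by
  obtain ⟨b, hb⟩ : ∃ b : Fin (M + 1), (b : ℕ) = s + j := ⟨⟨s + j, by omega⟩, rfl⟩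
  have hj : j = (b - s : ℕ) := by omega
  have hsubset : Finset.Ioc s b ⊆ possibleChangePoints (M + 1) := by
    rw [possibleChangePoints_succ]
    exact fun i hi => Finset.mem_Ioi.2 (hs.trans (Finset.mem_Ioc.1 hi).1)
  have hmem : s ∈ possibleChangePoints (M + 1) := by
    rwa [possibleChangePoints_succ, Finset.mem_Ioi]
  have := card_filter_mem_disjoint_powersetCard hsubset hmem Finset.left_notMem_Ioc k
  rwa [card_possibleChangePoints_succ, Fin.card_Ioc, ← hj,
    ← Finset.filter_congr fun S _ => mem_longBlocks_one_iff (S := S) (by omega), ← hj] at this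

theorem sum_card_longBlocks_eq (k j : ℕ) :
    ∑ S ∈ (possibleChangePoints (M + 1)).powersetCard k, (longBlocks S 1 j).card =
      ∑ s ∈ possibleChangePoints (M + 1),
        {S ∈ (possibleChangePoints (M + 1)).powersetCard k | s ∈ longBlocks S 1 j}.card := by
  refine .trans (Finset.sum_congr rfl fun S hS => congrArg Finset.card ?_)
    (Finset.sum_card_bipartiteAbove_eq_sum_card_bipartiteBelow fun S s => s ∈ longBlocks S 1 j)
  refine (Finset.filter_mem_eq_inter.trans (Finset.inter_eq_right.2 fun s hs => ?_)).symm
  exact (Finset.mem_powersetCard.1 hS).1 (Finset.mem_filter.1 hs).1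

/-- The main term counts the starting points `s ≤ M - j` exactly: their first `j` steps do not wrap
around. The other `j` starting points make up the error. -/
theorem abs_sum_card_longBlocks_sub_le {j : ℕ} (hj : j ≤ M) (k : ℕ) :
    |∑ S ∈ (possibleChangePoints (M + 1)).powersetCard k, ((longBlocks S 1 j).card : ℝ) -
      (M - j) * ((M - j).choose k - (M - j - 1).choose k)| ≤ j * M.choose k := by
  obtain ⟨b, hb⟩ : ∃ b : Fin (M + 1), (b : ℕ) = M - j := ⟨⟨M - j, by omega⟩, rfl⟩
  set P := possibleChangePoints (M + 1) with hP
  have hsubset : Finset.Ioc 0 b ⊆ P := by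
    rw [hP, possibleChangePoints_succ]
    exact Finset.Ioc_subset_Ioi_self
  have hcard : (Finset.Ioc 0 b).card = M - j := by rw [Fin.card_Ioc, hb]; simp
  let count (s : Fin (M + 1)) : ℕ := {S ∈ P.powersetCard k | s ∈ longBlocks S 1 j}.card
  have hsplit : ∑ S ∈ P.powersetCard k, ((longBlocks S 1 j).card : ℝ) =
      ∑ s ∈ P \ Finset.Ioc 0 b, (count s : ℝ) + ∑ s ∈ Finset.Ioc 0 b, (count s : ℝ) := by
    rw [Finset.sum_sdiff hsubset]
    exact_mod_cast sum_card_longBlocks_eq k j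
  have hinner : ∑ s ∈ Finset.Ioc 0 b, (count s : ℝ) =
      (M - j) * ((M - j).choose k - (M - j - 1).choose k) := by
    rw [Finset.sum_congr rfl fun s hs => ?_, Finset.sum_const, hcard, nsmul_eq_mul,
      Nat.cast_sub hj]
    obtain ⟨hs0, hsb⟩ := Finset.mem_Ioc.1 hs
    rw [eq_sub_iff_add_eq]
    exact_mod_cast card_filter_mem_longBlocks hs0 (by omega) k
  have houter : ∑ s ∈ P \ Finset.Ioc 0 b, (count s : ℝ) ≤ j * M.choose k := by
    refine (Finset.sum_le_card_nsmul _ _ (M.choose k : ℝ) fun s _ => ?_).trans_eq ?_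
    · have : count s ≤ (P.powersetCard k).card := Finset.card_filter_le _ _
      rw [Finset.card_powersetCard, hP, card_possibleChangePoints_succ] at this
      exact_mod_cast this
    · rw [Finset.card_sdiff_of_subset hsubset, hcard, hP, card_possibleChangePoints_succ,
        Nat.sub_sub_self hj, nsmul_eq_mul]
  rw [hsplit, hinner, add_sub_cancel_right,
    abs_of_nonneg (Finset.sum_nonneg fun _ _ => Nat.cast_nonneg _)]
  exact houter

end Counting

section Averages

/-- The average, over all `k`-element sets `S` of possible change points of a signal of length
`M + 1`, of the number of blocks of `S` with more than `j` elements, divided by `M + 1`. -/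
def meanLongBlocks (M k j : ℕ) : ℝ :=
  (∑ S ∈ (possibleChangePoints (M + 1)).powersetCard k, ((longBlocks S 1 j).card : ℝ)) /
    (M.choose k * (M + 1))

theorem meanLongBlocks_nonneg (M k j : ℕ) : 0 ≤ meanLongBlocks M k j := by
  unfold meanLongBlocks
  positivity

variable {M k : ℕ}

theorem nonempty_of_mem_powersetCard {α : Type*} {P S : Finset α} (hk : 0 < k)
    (hS : S ∈ P.powersetCard k) : S.Nonempty :=
  Finset.card_pos.1 ((Finset.mem_powersetCard.1 hS).2.symm ▸ hk)

theorem meanLongBlocks_le (hk : 0 < k) (j : ℕ) : meanLongBlocks M k j ≤ 1 / (j + 1) := by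
  refine div_le_of_le_mul₀ (by positivity) (by positivity) ?_
  refine (Finset.sum_le_card_nsmul _ _ (((M : ℝ) + 1) / (j + 1)) fun S hS => ?_).trans_eq ?_
  · rw [le_div_iff₀' (by positivity)]
    have := succ_mul_card_longBlocks_le
      (exists_sub_nsmul_one_mem (nonempty_of_mem_powersetCard hk hS)) j
    rw [Fintype.card_fin] at this
    exact_mod_cast this
  · rw [Finset.card_powersetCard, card_possibleChangePoints_succ, nsmul_eq_mul]
    ring

theorem meanLongBlocks_eq_zero (hk : 0 < k) {j : ℕ} (hj : M + 1 ≤ j) :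
    meanLongBlocks M k j = 0 := by
  rw [meanLongBlocks, Finset.sum_eq_zero fun S hS => ?_, zero_div]
  have := succ_mul_card_longBlocks_le
    (exists_sub_nsmul_one_mem (nonempty_of_mem_powersetCard hk hS)) j
  rw [Fintype.card_fin] at this
  exact_mod_cast (by nlinarith : (longBlocks S 1 j).card = 0)

theorem abs_meanLongBlocks_sub_le {j : ℕ} (hj : j ≤ M) (hk : k ≤ M) :
    |meanLongBlocks M k j - (1 - ((j : ℝ) + 1) / (M + 1)) *
      (((M - j).choose k : ℝ) / M.choose k - ((M - (j + 1)).choose k : ℝ) / M.choose k)| ≤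
      j / (M + 1) := by
  have hchoose : (0 : ℝ) < M.choose k := by exact_mod_cast Nat.choose_pos hk
  have hscale : (0 : ℝ) < M.choose k * (M + 1) := by positivity
  have hscaled : (1 - ((j : ℝ) + 1) / (M + 1)) *
      (((M - j).choose k : ℝ) / M.choose k - ((M - (j + 1)).choose k : ℝ) / M.choose k) =
      (M - j) * ((M - j).choose k - (M - j - 1).choose k) / (M.choose k * (M + 1)) := by
    rw [← Nat.sub_sub]
    field_simp
    ring
  rw [meanLongBlocks, hscaled, ← sub_div, abs_div, abs_of_pos hscale, div_le_iff₀ hscale]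
  refine (abs_sum_card_longBlocks_sub_le hj k).trans_eq ?_
  field_simp

theorem averageNormalizedSD_eq_tsum {N : ℕ} (hN : 0 < N) (hk : 0 < k)
    {x : Finset (Fin N) → EuclideanSpace ℝ (Fin N)}
    (hx : ∀ S ∈ (possibleChangePoints N).powersetCard k,
      Monotone (fun i => x S i) ∧ changePoints (x S) = S) :
    averageNormalizedSD N k x = ∑' j : ℕ, meanLongBlocks (N - 1) k j / (j + 1) := by
  obtain ⟨M, rfl⟩ : ∃ M, N = M + 1 := Nat.exists_eq_succ_of_ne_zero hN.ne'
  rw [Nat.add_sub_cancel]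
  have hstatDim (S) (hS : S ∈ (possibleChangePoints (M + 1)).powersetCard k) :
      statDim (descentCone (monotoneTV (M + 1)) (x S)) =
        ∑ j ∈ Finset.range (M + 1), ((longBlocks S 1 j).card : ℝ) / (j + 1) := by
    obtain ⟨hmono, hchange⟩ := hx S hS
    have hne := nonempty_of_mem_powersetCard hk hS
    rw [statDim_descentCone_monotoneTV hmono (hchange.symm ▸ hne), hchange,
      sum_harmonic_blockLength (exists_sub_nsmul_one_mem hne), Fintype.card_fin]
  rw [tsum_eq_sum (s := Finset.range (M + 1)) fun j hj => by
    rw [meanLongBlocks_eq_zero hk (by simpa using hj), zero_div]]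
  rw [averageNormalizedSD, Finset.card_powersetCard, card_possibleChangePoints_succ,
    ← Finset.sum_div, Finset.sum_congr rfl hstatDim, Finset.sum_comm, div_div, Finset.sum_div,
    Nat.cast_add_one, mul_comm (_ + 1)]
  refine Finset.sum_congr rfl fun j _ => ?_
  rw [meanLongBlocks, ← Finset.sum_div, div_right_comm]

end Averages

section Limits

variable {ε : ℝ} {N M k : ℕ → ℕ}

theorem tendsto_natCast_div_sub (hN : Tendsto N atTop atTop)
    (hk : Tendsto (fun n => (k n : ℝ) / N n) atTop (𝓝 ε)) (j : ℕ) :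
    Tendsto (fun n => (k n : ℝ) / (N n - j : ℕ)) atTop (𝓝 ε) := by
  have hratio := hk.mul ((tendsto_natCast_div_add_atTop (-j : ℝ)).comp hN)
  rw [mul_one] at hratio
  refine hratio.congr' ?_
  filter_upwards [hN.eventually_gt_atTop j] with n hn
  have hN0 : (N n : ℝ) ≠ 0 := by exact_mod_cast (Nat.zero_le j |>.trans_lt hn).ne'
  rw [Function.comp_apply, ← sub_eq_add_neg, ← Nat.cast_sub hn.le, div_mul_div_cancel₀ hN0]

theorem eventually_le_of_tendsto_div_lt_one (hε1 : ε < 1) (hN : Tendsto N atTop atTop)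
    (hk : Tendsto (fun n => (k n : ℝ) / N n) atTop (𝓝 ε)) : ∀ᶠ n in atTop, k n ≤ N n := by
  filter_upwards [hN.eventually_gt_atTop 0, hk.eventually_lt_const hε1] with n hpos hlt
  rw [div_lt_one (by exact_mod_cast hpos)] at hlt
  exact_mod_cast hlt.le

theorem choose_div_choose_succ {n k : ℕ} (hk : k ≤ n + 1) :
    (n.choose k : ℝ) / (n + 1).choose k = 1 - k / (n + 1 : ℕ) := by
  have hchoose : ((n + 1).choose k : ℝ) ≠ 0 := by exact_mod_cast (Nat.choose_pos hk).ne'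
  have hsucc : ((n + 1 : ℕ) : ℝ) ≠ 0 := by positivity
  have hmul : (n.choose k : ℝ) * (n + 1 : ℕ) = (n + 1).choose k * ((n + 1 : ℕ) - k) := by
    rw [← Nat.cast_sub hk]
    exact_mod_cast Nat.choose_mul_succ_eq n k
  field_simp
  linarith

theorem tendsto_choose_sub_div_choose (hε1 : ε < 1) (hM : Tendsto M atTop atTop)
    (hk : Tendsto (fun n => (k n : ℝ) / M n) atTop (𝓝 ε)) (j : ℕ) :
    Tendsto (fun n => ((M n - j).choose (k n) : ℝ) / (M n).choose (k n)) atTop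
      (𝓝 ((1 - ε) ^ j)) := by
  induction j with
  | zero =>
    refine tendsto_const_nhds.congr' ?_
    filter_upwards [eventually_le_of_tendsto_div_lt_one hε1 hM hk] with n hle
    rw [pow_zero, Nat.sub_zero, div_self]
    exact_mod_cast (Nat.choose_pos hle).ne'
  | succ j ih =>
    have hshift := tendsto_natCast_div_sub hM hk j
    rw [pow_succ']
    refine ((hshift.const_sub 1).mul ih).congr' ?_
    filter_upwards [hM.eventually_gt_atTop j, eventually_le_of_tendsto_div_lt_one hε1
      ((tendsto_sub_atTop_nat j).comp hM) hshift] with n hj hle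
    obtain ⟨m, hm⟩ : ∃ m, M n - j = m + 1 := Nat.exists_eq_succ_of_ne_zero (by omega)
    rw [Function.comp_apply, hm] at hle
    have hchoose : ((m + 1).choose (k n) : ℝ) ≠ 0 := by
      exact_mod_cast (Nat.choose_pos hle).ne'
    rw [hm, ← choose_div_choose_succ hle, div_mul_div_cancel₀ hchoose,
      show M n - (j + 1) = m by omega]

theorem tendsto_meanLongBlocks (hε1 : ε < 1) (hM : Tendsto M atTop atTop)
    (hk : Tendsto (fun n => (k n : ℝ) / M n) atTop (𝓝 ε)) (j : ℕ) :
    Tendsto (fun n => meanLongBlocks (M n) (k n) j) atTop (𝓝 (ε * (1 - ε) ^ j)) := by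
  have hMsucc : Tendsto (fun n => (M n : ℝ) + 1) atTop atTop :=
    tendsto_atTop_add_const_right _ _ (tendsto_natCast_atTop_atTop.comp hM)
  have hboundary : Tendsto (fun n => (j : ℝ) / (M n + 1)) atTop (𝓝 0) :=
    tendsto_const_nhds.div_atTop hMsucc
  have hinner : Tendsto (fun n => (1 - ((j : ℝ) + 1) / (M n + 1)) *
      (((M n - j).choose (k n) : ℝ) / (M n).choose (k n) -
        ((M n - (j + 1)).choose (k n) : ℝ) / (M n).choose (k n)))
      atTop (𝓝 (ε * (1 - ε) ^ j)) := by
    have hratio (i : ℕ) := tendsto_choose_sub_div_choose hε1 hM hk i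
    convert ((tendsto_const_nhds.div_atTop hMsucc).const_sub 1).mul
      ((hratio j).sub (hratio (j + 1))) using 2
    ring
  refine tendsto_of_tendsto_of_dist hinner
    (squeeze_zero' (.of_forall fun _ => dist_nonneg) ?_ hboundary)
  filter_upwards [hM.eventually_ge_atTop j, eventually_le_of_tendsto_div_lt_one hε1 hM hk]
    with n hj hle
  rw [dist_comm, Real.dist_eq]
  exact abs_meanLongBlocks_sub_le hj hle

theorem tsum_geometric_div (hε0 : 0 < ε) (hε1 : ε < 1) :
    ∑' j : ℕ, ε * (1 - ε) ^ j / (j + 1) = ε * Real.log (1 / ε) / (1 - ε) := by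
  have hlog := Real.hasSum_pow_div_log_of_abs_lt_one (x := 1 - ε)
    (by rw [abs_of_pos (by linarith)]; linarith)
  have hne : 1 - ε ≠ 0 := by linarith
  rw [sub_sub_cancel] at hlog
  rw [one_div, Real.log_inv, mul_div_right_comm, ← (hlog.mul_left (ε / (1 - ε))).tsum_eq]
  refine tsum_congr fun j => ?_
  rw [pow_succ]
  field_simp

theorem tendsto_tsum_meanLongBlocks (hε0 : 0 < ε) (hε1 : ε < 1) (hM : Tendsto M atTop atTop)
    (hk : Tendsto (fun n => (k n : ℝ) / M n) atTop (𝓝 ε)) (hkpos : ∀ᶠ n in atTop, 0 < k n) :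
    Tendsto (fun n => ∑' j : ℕ, meanLongBlocks (M n) (k n) j / (j + 1)) atTop
      (𝓝 (ε * Real.log (1 / ε) / (1 - ε))) := by
  have hsummable : Summable fun j : ℕ => 1 / ((j : ℝ) + 1) / (j + 1) := by
    have := (summable_nat_add_iff 1).2 (Real.summable_one_div_nat_pow.2 one_lt_two)
    simpa only [Nat.cast_add, Nat.cast_one, sq, ← div_div] using this
  rw [← tsum_geometric_div hε0 hε1]
  refine tendsto_tsum_of_dominated_convergence hsummable
    (fun j => (tendsto_meanLongBlocks hε1 hM hk j).div_const _) ?_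
  filter_upwards [hkpos] with n hpos j
  rw [Real.norm_of_nonneg (div_nonneg (meanLongBlocks_nonneg _ _ _) (by positivity))]
  gcongr
  exact meanLongBlocks_le hpos j

end Limits

end

theorem mainTheorem2 (ε : ℝ) (hε0 : 0 < ε) (hε1 : ε < 1) (N k : ℕ → ℕ)
    (hN : Tendsto N atTop atTop)
    (hk : Tendsto (fun n => (k n : ℝ) / (N n : ℝ)) atTop (𝓝 ε))
    (x : (n : ℕ) → Finset (Fin (N n)) → EuclideanSpace ℝ (Fin (N n)))
    (hx : ∀ n, ∀ S ∈ (possibleChangePoints (N n)).powersetCard (k n),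
      Monotone (fun i => x n S i) ∧ changePoints (x n S) = S) :
    Tendsto (fun n => averageNormalizedSD (N n) (k n) (x n)) atTop
      (𝓝 (ε * Real.log (1 / ε) / (1 - ε))) := by
  have hkpos : ∀ᶠ n in atTop, 0 < k n := by
    filter_upwards [hk.eventually_const_lt hε0] with n hpos
    exact Nat.pos_of_ne_zero fun hzero => by simp [hzero] at hpos
  refine (tendsto_tsum_meanLongBlocks hε0 hε1 ((tendsto_sub_atTop_nat 1).comp hN)
    (tendsto_natCast_div_sub hN hk 1) hkpos).congr' ?_
  filter_upwards [hN.eventually_gt_atTop 0, hkpos] with n hNpos hpos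
  exact (averageNormalizedSD_eq_tsum hNpos hpos (hx n)).symm
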